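/- For $N\ge 0$ put $(a;q)_N=\prod_{i=0}^{N-1}(1-aq^i)$, and for $N=-M<0$ put $(a;q)_{-M}=\prod_{i=1}^{M}(1-aq^{-i})^{-1}$. Let $n\ge 0$, let $\mathbf k=(k_1,\dots,k_s)$ be $s\ge 0$ positive integers, $|\mathbf k|=k_1+\cdots+k_s$, and let $q$, $x=(x_1,\dots,x_n)$, $z=(z_1,\dots,z_s)$ be indeterminates or, more generally, nonzero elements of a field for which no denominator below vanishes. Then \begin{multline*} \sum_{\sigma\in\{-1,+1\}^n} \prod_{i=1}^n\left(\frac{1-qx_i^{2\sigma_i}}{1-x_i^{2\sigma_i}} \prod_{l=1}^s\frac{1-q^{k_l}z_lx_i^{-\sigma_i}}{1-z_lx_i^{-\sigma_i}}\right) \prod_{1\le i<j\le n}\frac{1-qx_i^{\sigma_i}x_j^{\sigma_j}}{1-x_i^{\sigma_i}x_j^{\sigma_j}}\\ =q^{n|\mathbf k|-\binom{|\mathbf k|}{2}}\,(-q;q)_{n-|\mathbf k|} \prod_{1\le a<b\le s}\frac{(q^{k_b+1}z_az_b;q)_{k_a}}{(qz_az_b;q)_{k_a}} \prod_{a=1}^s\frac{(qz_a^2;q^2)_{k_a}}{(qz_a^2;q)_{k_a}}\\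 \times\sum_{\mathbf m\le\mathbf k}(-1)^{|\mathbf m|}\,c_{\mathbf m}\,q^{(|\mathbf k|-n)|\mathbf m|} \prod_{i=1}^n\prod_{l=1}^s\frac{(qx_iz_l;q)_{m_l}}{(x_iz_l;q)_{m_l}}\,\frac{(qz_l/x_i;q)_{m_l}}{(z_l/x_i;q)_{m_l}}, \end{multline*} where $\mathbf m=(m_1,\dots,m_s)$ runs over the integer vectors with $0\le m_l\le k_l$ for all $l$, $|\mathbf m|=m_1+\cdots+m_s$, and \[ c_{\mathbf m}=\prod_{1\le a<b\le s}\frac{q^{m_a}z_a-q^{m_b}z_b}{z_a-z_b} \prod_{1\le a\le b\le s}\frac{1-q^{m_a+m_b}z_az_b}{1-z_az_b} \prod_{a,b=1}^s\frac{(q^{-k_b}z_a/z_b;q)_{m_a}}{(qz_a/z_b;q)_{m_a}}\,\frac{(z_az_b;q)_{m_a}}{(q^{1+k_b}z_az_b;q)_{m_a}}. \] -/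

import Mathlib

/-- The `q`-shifted factorial `(a; q)_n = (1 - a) (1 - a q) ⋯ (1 - a q ^ (n - 1))`. -/
def qPoch {K : Type*} [Field K] (a q : K) (n : ℕ) : K :=
  ∏ i ∈ Finset.range n, (1 - a * q ^ i)

/-- The `q`-shifted factorial with an integer index: `(a; q)_N = (a; q)_∞ / (a q ^ N; q)_∞`.
For a negative index `N = -M` this is `1 / ((1 - a q ^ (-M)) ⋯ (1 - a q ^ (-1)))`. -/
def qPochInt {K : Type*} [Field K] (a q : K) : ℤ → K
  | Int.ofNat N => qPoch a q N
  | Int.negSucc M => (qPoch (a * q ^ (-((M : ℤ) + 1))) q (M + 1))⁻¹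

/-- The coefficient `c_m` of the multiple sum. -/
def coeffC {K : Type*} [Field K] {s : ℕ} (q : K) (k : Fin s → ℕ) (z : Fin s → K)
    (m : Fin s → ℕ) : K :=
  (∏ a, ∏ b ∈ Finset.Ioi a, (q ^ m a * z a - q ^ m b * z b) / (z a - z b)) *
  (∏ a, ∏ b ∈ Finset.Ici a, (1 - q ^ (m a + m b) * z a * z b) / (1 - z a * z b)) *
  ∏ a, ∏ b,
    (qPoch (q ^ (-(k b : ℤ)) * (z a / z b)) q (m a) / qPoch (q * (z a / z b)) q (m a)) *
    (qPoch (z a * z b) q (m a) / qPoch (q ^ (1 + k b) * (z a * z b)) q (m a))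

/-!
Both sides of the formula are values of signed sums over two families of variables. Suppose first
that all `k_l = 1`. With `z` rescaled by `q ^ (1 / 2)`, the right-hand side is a sum over the signs
of `z` of the same shape as the left-hand side, so that the formula becomes a duality between the
families `x` and `z`. As a function of one variable `Z` of the second family, the difference of the
two sides, multiplied by its denominators, is a polynomial of degree `2 (n + s - 1)`. It vanishes at
the points `x_i` and `x_i⁻¹`, by the duality with `x_i` and `Z` removed, and at `z_a` and
`(q z_a)⁻¹`, since there the terms cancel in pairs. One further zero is `0` if there is no variable
`x`, and otherwise the reflection `(q x_i)⁻¹` of `x_i`; so the difference is zero.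

In general, replace each `z_l` by the geometric progression `z_l, q z_l, …, q ^ (k_l - 1) z_l`. The
weights of `x` telescope. The term of a choice of signs of `z` vanishes unless the negative signs
form an initial segment of every progression, and the lengths `m_l` of these segments index the sum
on the right-hand side. The argument requires generic parameters; the identity between rational
functions is then specialised to an arbitrary field.
-/

section signSum

variable {R ι : Type*} [LinearOrder ι]

theorem prod_lt_insert [CommMonoid R] {f : ι → ι → R} (hf : ∀ i j, f i j = f j i) {a : ι}
    {I : Finset ι} (ha : a ∉ I) :
    ∏ i ∈ insert a I, ∏ j ∈ insert a I with i < j, f i j =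
      (∏ i ∈ I, f a i) * ∏ i ∈ I, ∏ j ∈ I with i < j, f i j := by
  have row_a : ∏ j ∈ insert a I with a < j, f a j = ∏ j ∈ I, if a < j then f a j else 1 := by
    simp [Finset.prod_filter, Finset.prod_insert ha]
  have row (i : ι) : ∏ j ∈ insert a I with i < j, f i j =
      (if i < a then f i a else 1) * ∏ j ∈ I with i < j, f i j := by
    simp only [Finset.prod_filter, Finset.prod_insert ha]
  rw [Finset.prod_insert ha, row_a]
  simp only [row]
  rw [Finset.prod_mul_distrib, ← mul_assoc, ← Finset.prod_mul_distrib]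
  congr 1
  refine Finset.prod_congr rfl fun i hi => ?_
  obtain h | h := lt_or_gt_of_ne (ne_of_mem_of_not_mem hi ha)
  · simp [h, not_lt_of_gt h, hf i a]
  · simp [h, not_lt_of_gt h]

variable [CommSemiring R]

/-- The weight of a choice of signs `τ` on `I`, built from one-point weights `A` and two-point
weights `G`. The sign `true` stands for `-1`. -/
def signTerm (I : Finset ι) (A : ι → Bool → R) (G : ι → Bool → ι → Bool → R) (τ : ι → Bool) : R :=
  (∏ i ∈ I, A i (τ i)) * ∏ i ∈ I, ∏ j ∈ I with i < j, G i (τ i) j (τ j)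

/-- The sum of `signTerm` over all choices of signs on `I`. A choice of signs is encoded by the
subset of `I` on which the sign is negative. -/
def signSum (I : Finset ι) (A : ι → Bool → R) (G : ι → Bool → ι → Bool → R) : R :=
  ∑ S ∈ I.powerset, signTerm I A G fun i => decide (i ∈ S)

variable {I : Finset ι} {A B : ι → Bool → R} {G : ι → Bool → ι → Bool → R}

theorem signTerm_congr {τ τ' : ι → Bool} (hA : ∀ i ∈ I, ∀ δ, A i δ = B i δ)
    (hτ : ∀ i ∈ I, τ i = τ' i) : signTerm I A G τ = signTerm I B G τ' := by
  unfold signTerm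
  congr 1
  · exact Finset.prod_congr rfl fun i hi => by rw [hA i hi, hτ i hi]
  · refine Finset.prod_congr rfl fun i hi => Finset.prod_congr rfl fun j hj => ?_
    rw [hτ i hi, hτ j (Finset.mem_filter.1 hj).1]

theorem signTerm_insert (hG : ∀ i ε j δ, G i ε j δ = G j δ i ε) {a : ι} (ha : a ∉ I)
    (A : ι → Bool → R) (τ : ι → Bool) :
    signTerm (insert a I) A G τ =
      A a (τ a) * signTerm I (fun i δ => A i δ * G a (τ a) i δ) G τ := by
  unfold signTerm
  rw [prod_lt_insert (f := fun i j => G i (τ i) j (τ j)) (fun i j => hG _ _ _ _) ha,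
    Finset.prod_insert ha, Finset.prod_mul_distrib]
  ring

@[simp]
theorem signSum_empty (A : ι → Bool → R) (G : ι → Bool → ι → Bool → R) : signSum ∅ A G = 1 := by
  simp [signSum, signTerm]

theorem signSum_insert (hG : ∀ i ε j δ, G i ε j δ = G j δ i ε) {a : ι} (ha : a ∉ I)
    (A : ι → Bool → R) :
    signSum (insert a I) A G =
      ∑ ε, A a ε * signSum I (fun i δ => A i δ * G a ε i δ) G := by
  unfold signSum
  rw [Finset.sum_powerset_insert ha, Fintype.sum_bool, add_comm, Finset.mul_sum, Finset.mul_sum]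
  congr 1 <;> refine Finset.sum_congr rfl fun S hS => ?_
  · rw [signTerm_insert hG ha]
    simp only [Finset.mem_insert_self, decide_true]
    rw [signTerm_congr (fun _ _ _ => rfl) fun i hi => ?_]
    simp [ne_of_mem_of_not_mem hi ha]
  · have haS : a ∉ S := fun h => ha (Finset.mem_powerset.1 hS h)
    simp only [signTerm_insert hG ha, haS, decide_false]

theorem signSum_congr (h : ∀ i ∈ I, ∀ δ, A i δ = B i δ) : signSum I A G = signSum I B G :=
  Finset.sum_congr rfl fun _ _ => signTerm_congr h fun _ _ => rfl

theorem signSum_eq_prod_mul (c : ι → R) (h : ∀ i ∈ I, ∀ δ, A i δ = c i * B i δ) :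
    signSum I A G = (∏ i ∈ I, c i) * signSum I B G := by
  rw [signSum_congr h]
  simp only [signSum, signTerm, Finset.mul_sum, Finset.prod_mul_distrib, mul_assoc]

end signSum

/-- `f` is given by a polynomial of degree at most `d`. -/
def IsPolyFun {R : Type*} [CommRing R] (d : ℕ) (f : R → R) : Prop :=
  ∃ P : Polynomial R, P.natDegree ≤ d ∧ ∀ z, P.eval z = f z

namespace IsPolyFun

variable {R : Type*} [CommRing R] {d e : ℕ} {f g : R → R}

theorem const (c : R) : IsPolyFun 0 fun _ => c :=
  ⟨Polynomial.C c, by simp, by simp⟩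

theorem mono (hf : IsPolyFun d f) (h : d ≤ e) : IsPolyFun e f := by
  obtain ⟨P, hP, hf⟩ := hf
  exact ⟨P, hP.trans h, hf⟩

theorem add (hf : IsPolyFun d f) (hg : IsPolyFun d g) : IsPolyFun d fun z => f z + g z := by
  obtain ⟨P, hP, hf⟩ := hf
  obtain ⟨Q, hQ, hg⟩ := hg
  exact ⟨P + Q, (Polynomial.natDegree_add_le _ _).trans (max_le hP hQ), by simp [hf, hg]⟩

theorem mul (hf : IsPolyFun d f) (hg : IsPolyFun e g) : IsPolyFun (d + e) fun z => f z * g z := by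
  obtain ⟨P, hP, hf⟩ := hf
  obtain ⟨Q, hQ, hg⟩ := hg
  exact ⟨P * Q, Polynomial.natDegree_mul_le.trans (add_le_add hP hQ), by simp [hf, hg]⟩

theorem const_mul (c : R) (hf : IsPolyFun d f) : IsPolyFun d fun z => c * f z := by
  simpa using (const c).mul hf

theorem sub (hf : IsPolyFun d f) (hg : IsPolyFun d g) : IsPolyFun d fun z => f z - g z := by
  simpa [sub_eq_add_neg] using hf.add (hg.const_mul (-1))

theorem linear_mul_linear (a b c d : R) : IsPolyFun 2 fun z => (a + b * z) * (c + d * z) := by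
  have linear (a b : R) : IsPolyFun 1 fun z => a + b * z :=
    ⟨Polynomial.C a + Polynomial.C b * Polynomial.X, by compute_degree, by simp⟩
  exact (linear a b).mul (linear c d)

theorem sum {α : Type*} {s : Finset α} {f : α → R → R} (hf : ∀ i ∈ s, IsPolyFun d (f i)) :
    IsPolyFun d fun z => ∑ i ∈ s, f i z := by
  classical
  induction s using Finset.induction_on with
  | empty => simpa using (const (0 : R)).mono (Nat.zero_le d)
  | insert a s ha ih =>
    simp only [Finset.sum_insert ha]
    exact (hf a (by simp)).add (ih fun i hi => hf i (by simp [hi]))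

theorem prod {α : Type*} {s : Finset α} {f : α → R → R} (hf : ∀ i ∈ s, IsPolyFun d (f i)) :
    IsPolyFun (d * s.card) fun z => ∏ i ∈ s, f i z := by
  classical
  induction s using Finset.induction_on with
  | empty => simpa using const (1 : R)
  | insert a s ha ih =>
    simp only [Finset.prod_insert ha, Finset.card_insert_of_notMem ha]
    exact ((hf a (by simp)).mul (ih fun i hi => hf i (by simp [hi]))).mono (by ring_nf; rfl)

theorem signSum {ι : Type*} [LinearOrder ι] {I : Finset ι} {A : R → ι → Bool → R}
    (G : ι → Bool → ι → Bool → R) (hA : ∀ i ∈ I, ∀ δ, IsPolyFun d fun z => A z i δ) :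
    IsPolyFun (d * I.card) fun z => signSum I (A z) G :=
  sum fun _ _ => by simpa [signTerm] using (prod fun i hi => hA i hi _).mul (const _)

theorem eq_zero [IsDomain R] (hf : IsPolyFun d f) {s : Finset R} (hs : d < s.card)
    (h : ∀ z ∈ s, f z = 0) (z : R) : f z = 0 := by
  obtain ⟨P, hP, hf⟩ := hf
  have : P = 0 := Polynomial.eq_zero_of_natDegree_lt_card_of_eval_eq_zero' P s
    (fun z hz => by rw [hf, h z hz]) (hP.trans_lt hs)
  rw [← hf, this, Polynomial.eval_zero]

end IsPolyFun

/-! ### Duality for multiplicities one -/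

section kernels

variable {K ι κ : Type*} [Field K]

/-- `x` or `x⁻¹`, according to a sign. -/
def signPow (x : K) (ε : Bool) : K := bif ε then x⁻¹ else x

/-- The two-point weight `(1 - q p) / (1 - p)`. -/
def pairKernel (q p : K) : K := (1 - q * p) / (1 - p)

/-- The product `w ^ ε * w' ^ δ`, where `w ^ 2 = q u ^ 2` and `w' ^ 2 = q v ^ 2`. In this symmetric
normalization the variables `z` interact exactly like the variables `x`; no square root of `q` is
needed to write the product down. -/
def dualArg (q u v : K) : Bool → Bool → K
  | false, false => q * (u * v)
  | false, true => u / v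
  | true, false => v / u
  | true, true => (q * (u * v))⁻¹

/-- The two-point weight of the signed sum over the variables `x`. -/
def kernX (q : K) (x : ι → K) (i : ι) (ε : Bool) (j : ι) (δ : Bool) : K :=
  pairKernel q (signPow (x i) ε * signPow (x j) δ)

/-- The two-point weight of the signed sum over the variables `z`. -/
def kernZ (q : K) (z : κ → K) (a : κ) (ε : Bool) (b : κ) (δ : Bool) : K :=
  pairKernel q (dualArg q (z a) (z b) ε δ)

/-- The one-point weight of the signed sum over the variables `x`. -/
def weightX (q : K) (x : ι → K) (z : κ → K) (T : Finset κ) (i : ι) (ε : Bool) : K :=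
  (1 - q * signPow (x i) ε ^ 2) / (1 - signPow (x i) ε ^ 2) *
    ∏ l ∈ T, (1 - q * z l * signPow (x i) (!ε)) / (1 - z l * signPow (x i) (!ε))

/-- The factor which a variable `x` contributes to the weight of a variable `z` with negative
sign. -/
def crossFactor (q x z : K) : K :=
  (1 - q * (x * z)) * (1 - q * (z / x)) / (q * ((1 - x * z) * (1 - z / x)))

/-- The one-point weight of the signed sum over the variables `z`. -/
def weightZ (q : K) (x : ι → K) (z : κ → K) (I : Finset ι) (a : κ) (ε : Bool) : K :=
  bif ε then ∏ i ∈ I, crossFactor q (x i) (z a) else 1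

/-- The parameters avoid all the coincidences that matter for the interpolation argument. -/
structure Generic (q : K) (x : ι → K) (z : κ → K) : Prop where
  q_ne : q ≠ 0
  q_zpow : ∀ j : ℤ, q ^ j ≠ -1
  x_ne : ∀ i, x i ≠ 0
  z_ne : ∀ a, z a ≠ 0
  xx_mul : ∀ i j, x i * x j ≠ 1
  xx_ne : ∀ i j, i ≠ j → x i ≠ x j
  qxx_mul : ∀ i j, q * (x i * x j) ≠ 1
  qxx_ne : ∀ i j, q * x i ≠ x j
  zz_ne : ∀ a b, a ≠ b → z a ≠ z b
  qzz_mul : ∀ a b, q * (z a * z b) ≠ 1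
  zx_mul : ∀ a i, z a * x i ≠ 1
  zx_ne : ∀ a i, z a ≠ x i
  qzx_mul : ∀ a i, q * (z a * x i) ≠ 1
  qzx_ne : ∀ a i, q * z a ≠ x i

theorem signPow_ne_zero {x : K} (hx : x ≠ 0) (ε : Bool) : signPow x ε ≠ 0 := by
  cases ε <;> simpa [signPow] using hx

theorem signPow_not (x : K) (ε : Bool) : signPow x (!ε) = (signPow x ε)⁻¹ := by
  cases ε <;> simp [signPow]

theorem apply_signPow_inv {α : Type*} {f : K → K → α} (hf : ∀ u v, f u v = f v u) (x : K)
    (ε : Bool) : f (signPow x ε) (signPow x ε)⁻¹ = f x x⁻¹ := by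
  cases ε
  · rfl
  · simp [signPow, hf x⁻¹ x]

theorem crossFactor_signPow (q x z : K) (ε : Bool) :
    crossFactor q (signPow x ε) z = crossFactor q x z := by
  have := apply_signPow_inv (f := fun u v => (1 - q * (u * z)) * (1 - q * (z * v)) /
    (q * ((1 - u * z) * (1 - z * v)))) (fun u v => by ring_nf) x ε
  simpa only [crossFactor, div_eq_mul_inv] using this

theorem dualArg_comm (q u v : K) (ε δ : Bool) : dualArg q u v ε δ = dualArg q v u δ ε := by
  cases ε <;> cases δ <;> simp [dualArg, mul_comm]

theorem kernX_comm (q : K) (x : ι → K) (i : ι) (ε : Bool) (j : ι) (δ : Bool) :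
    kernX q x i ε j δ = kernX q x j δ i ε := by
  simp only [kernX, mul_comm]

theorem kernZ_comm (q : K) (z : κ → K) (a : κ) (ε : Bool) (b : κ) (δ : Bool) :
    kernZ q z a ε b δ = kernZ q z b δ a ε := by
  simp only [kernZ, dualArg_comm q (z a)]

theorem weightZ_insert [DecidableEq ι] (q : K) (x : ι → K) (z : κ → K) {I : Finset ι} {i : ι}
    (hi : i ∉ I) (a : κ) (δ : Bool) :
    weightZ q x z (insert i I) a δ =
      (bif δ then crossFactor q (x i) (z a) else 1) * weightZ q x z I a δ := by
  cases δ <;> simp [weightZ, Finset.prod_insert hi]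

namespace Generic

variable {q : K} {x : ι → K} {z : κ → K}

theorem signPow_mul_signPow_ne_one (g : Generic q x z) {i j : ι} (h : i ≠ j) (ε δ : Bool) :
    signPow (x i) ε * signPow (x j) δ ≠ 1 := by
  have hxi := g.x_ne i
  have hxj := g.x_ne j
  cases ε <;> cases δ <;> simp only [signPow, cond_true, cond_false]
  · exact g.xx_mul i j
  · rw [ne_eq, mul_inv_eq_one₀ hxj]
    exact g.xx_ne i j h
  · rw [ne_eq, inv_mul_eq_one₀ hxi]
    exact g.xx_ne i j h
  · rw [← mul_inv]
    exact fun h => g.xx_mul i j (inv_eq_one.1 h)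

theorem signPow_sq_ne_one (g : Generic q x z) (i : ι) (ε : Bool) : signPow (x i) ε ^ 2 ≠ 1 := by
  have hi := g.xx_mul i i
  rw [← pow_two] at hi
  cases ε <;> simpa [signPow] using hi

theorem ne_signPow (g : Generic q x z) (a : κ) (i : ι) (ε : Bool) : z a ≠ signPow (x i) ε := by
  cases ε
  · exact g.zx_ne a i
  · exact fun h => g.zx_mul a i (by rw [h]; exact inv_mul_cancel₀ (g.x_ne i))

theorem one_sub_div_signPow_ne_zero (g : Generic q x z) (a : κ) (i : ι) (ε : Bool) :
    1 - z a / signPow (x i) ε ≠ 0 :=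
  sub_ne_zero.2 fun h => g.ne_signPow a i ε
    ((div_eq_one_iff_eq (signPow_ne_zero (g.x_ne i) ε)).1 h.symm)

theorem one_sub_mul_signPow_ne_zero (g : Generic q x z) (a : κ) (i : ι) (ε : Bool) :
    1 - z a * signPow (x i) ε ≠ 0 := by
  have := g.one_sub_div_signPow_ne_zero a i (!ε)
  rwa [signPow_not, div_inv_eq_mul] at this

theorem injective_z (g : Generic q x z) : Function.Injective z := fun a b h => by
  by_contra hne
  exact g.zz_ne a b hne h

end Generic

end kernels

section clearedDiff

variable {K ι κ : Type*} [Field K]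

/-- The denominator `(1 - Z x) (1 - Z / x)` of the cross factor of `x` and a variable `Z`, or its
numerator divided by `q`, according to the sign of `Z`. -/
def clearCross (q x Z : K) (ε : Bool) : K :=
  bif ε then (1 - q * Z * x) * (1 - q * Z / x) / q else (1 - Z * x) * (1 - Z / x)

/-- The factor which a variable `Z` contributes to the weight of a variable `x` of sign `δ`, with
its denominator cleared by `clearCross q x Z false`. -/
def clearX (q x Z : K) (δ : Bool) : K :=
  (1 - q * Z * signPow x (!δ)) * (1 - Z * signPow x δ)

/-- The two-point weight of `Z` with sign `ε` and `u` with sign `δ`, with its denominator cleared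
by `(1 - Z / u) (1 - q Z u)`. -/
def clearZ (q u Z : K) : Bool → Bool → K
  | false, false => (1 - q ^ 2 * Z * u) * (1 - Z / u)
  | false, true => (1 - q * Z / u) * (1 - q * Z * u)
  | true, false => (q - Z / u) * (1 - q * Z * u)
  | true, true => q * (1 - Z * u) * (1 - Z / u)

variable [LinearOrder ι] [LinearOrder κ]

/-- The signed sum over the variables `x`. -/
def sumX (q : K) (x : ι → K) (z : κ → K) (I : Finset ι) (T : Finset κ) : K :=
  signSum I (weightX q x z T) (kernX q x)

/-- The signed sum over the variables `z`. -/
def sumZ (q : K) (x : ι → K) (z : κ → K) (I : Finset ι) (T : Finset κ) : K :=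
  signSum T (weightZ q x z I) (kernZ q z)

/-- The sum `sumX` for `T` and one additional variable `Z`, multiplied by its denominators which
involve `Z`. -/
def clearedSumX (q : K) (x : ι → K) (z : κ → K) (I : Finset ι) (T : Finset κ) (Z : K) : K :=
  signSum I (fun i δ => weightX q x z T i δ * clearX q (x i) Z δ) (kernX q x)

/-- The part of the sum `sumZ` for `T` and one additional variable `Z` in which `Z` has sign `ε`,
multiplied by its denominators which involve `Z`. -/
def clearedSumZ (q : K) (x : ι → K) (z : κ → K) (I : Finset ι) (T : Finset κ) (Z : K)
    (ε : Bool) : K :=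
  (∏ i ∈ I, clearCross q (x i) Z ε) *
    signSum T (fun a δ => weightZ q x z I a δ * clearZ q (z a) Z ε δ) (kernZ q z)

/-- The difference of `sumX` and `C` times `sumZ`, as a function of one additional variable `Z` of
the second kind, multiplied by all denominators which involve `Z`. -/
def clearedDiff (q : K) (x : ι → K) (z : κ → K) (I : Finset ι) (T : Finset κ) (C Z : K) : K :=
  (∏ a ∈ T, (1 - Z / z a) * (1 - q * Z * z a)) * clearedSumX q x z I T Z -
    C * ∑ ε, clearedSumZ q x z I T Z ε

theorem isPolyFun_clearCross (q x : K) (ε : Bool) :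
    IsPolyFun 2 fun Z => clearCross q x Z ε := by
  cases ε
  · convert IsPolyFun.linear_mul_linear 1 (-x) 1 (-x⁻¹) using 2
    simp only [clearCross, cond_false]; ring
  · convert IsPolyFun.linear_mul_linear q⁻¹ (-(q * x) * q⁻¹) 1 (-(q * x⁻¹)) using 2
    simp only [clearCross, cond_true]; ring

theorem isPolyFun_clearX (q x : K) (δ : Bool) : IsPolyFun 2 fun Z => clearX q x Z δ := by
  convert IsPolyFun.linear_mul_linear 1 (-(q * signPow x (!δ))) 1 (-signPow x δ) using 2
  unfold clearX
  ring

theorem isPolyFun_clearZ (q u : K) (ε δ : Bool) : IsPolyFun 2 fun Z => clearZ q u Z ε δ := by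
  cases ε <;> cases δ
  · convert IsPolyFun.linear_mul_linear 1 (-(q ^ 2 * u)) 1 (-u⁻¹) using 2
    simp only [clearZ]; ring
  · convert IsPolyFun.linear_mul_linear 1 (-(q * u⁻¹)) 1 (-(q * u)) using 2
    simp only [clearZ]; ring
  · convert IsPolyFun.linear_mul_linear q (-u⁻¹) 1 (-(q * u)) using 2
    simp only [clearZ]; ring
  · convert IsPolyFun.linear_mul_linear q (-(q * u)) 1 (-u⁻¹) using 2
    simp only [clearZ]; ring

theorem isPolyFun_clearedDiff (q : K) (x : ι → K) (z : κ → K) (I : Finset ι) (T : Finset κ)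
    (C : K) : IsPolyFun (2 * I.card + 2 * T.card) (clearedDiff q x z I T C) := by
  have hden : IsPolyFun (2 * T.card) fun Z => ∏ a ∈ T, (1 - Z / z a) * (1 - q * Z * z a) := by
    refine IsPolyFun.prod fun a _ => ?_
    convert IsPolyFun.linear_mul_linear 1 (-(z a)⁻¹) 1 (-(q * z a)) using 2
    ring
  have hX : IsPolyFun (2 * I.card) (clearedSumX q x z I T) :=
    IsPolyFun.signSum _ fun i _ δ => (isPolyFun_clearX q (x i) δ).const_mul _
  have hZ (ε) : IsPolyFun (2 * I.card + 2 * T.card) fun Z => clearedSumZ q x z I T Z ε :=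
    (IsPolyFun.prod fun i _ => isPolyFun_clearCross q (x i) ε).mul
      (IsPolyFun.signSum _ fun a _ δ => (isPolyFun_clearZ q (z a) ε δ).const_mul _)
  exact ((hden.mul hX).mono (by omega)).sub ((IsPolyFun.sum fun ε _ => hZ ε).const_mul C)

end clearedDiff

section reflection

variable {K ι κ : Type*} [Field K] {q Z : K}

theorem clearCross_reflect {x : K} (hq : q ≠ 0) (hZ : Z ≠ 0) (hx : x ≠ 0) (ε : Bool) :
    clearCross q x (q * Z)⁻¹ ε = (q * Z ^ 2)⁻¹ * clearCross q x Z !ε := by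
  cases ε <;> simp only [clearCross, cond_true, cond_false, Bool.not_true, Bool.not_false] <;>
    field_simp <;> ring

theorem clearX_reflect {x : K} (hq : q ≠ 0) (hZ : Z ≠ 0) (hx : x ≠ 0) (δ : Bool) :
    clearX q x (q * Z)⁻¹ δ = (q * Z ^ 2)⁻¹ * clearX q x Z δ := by
  have := signPow_ne_zero hx δ
  rw [clearX, clearX, signPow_not]
  field_simp
  ring

theorem clearZ_reflect {u : K} (hq : q ≠ 0) (hZ : Z ≠ 0) (hu : u ≠ 0) (ε δ : Bool) :
    clearZ q u (q * Z)⁻¹ ε δ = (q * Z ^ 2)⁻¹ * clearZ q u Z (!ε) δ := by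
  cases ε <;> cases δ <;> simp only [clearZ, Bool.not_true, Bool.not_false] <;>
    field_simp <;> ring

variable [LinearOrder ι] [LinearOrder κ] {x : ι → K} {z : κ → K}

theorem clearedDiff_reflect (hq : q ≠ 0) (hZ : Z ≠ 0) (hx : ∀ i, x i ≠ 0) (hz : ∀ a, z a ≠ 0)
    (I : Finset ι) (T : Finset κ) (C : K) :
    clearedDiff q x z I T C (q * Z)⁻¹ =
      (q * Z ^ 2)⁻¹ ^ (I.card + T.card) * clearedDiff q x z I T C Z := by
  have hden : ∏ a ∈ T, (1 - (q * Z)⁻¹ / z a) * (1 - q * (q * Z)⁻¹ * z a) =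
      (q * Z ^ 2)⁻¹ ^ T.card * ∏ a ∈ T, (1 - Z / z a) * (1 - q * Z * z a) := by
    rw [← Finset.prod_const, ← Finset.prod_mul_distrib]
    refine Finset.prod_congr rfl fun a _ => ?_
    have := hz a
    field_simp
    ring
  have hX : clearedSumX q x z I T (q * Z)⁻¹ =
      (q * Z ^ 2)⁻¹ ^ I.card * clearedSumX q x z I T Z := by
    rw [← Finset.prod_const]
    exact signSum_eq_prod_mul _ fun i _ δ => by rw [clearX_reflect hq hZ (hx i)]; ring
  have hZ' (ε) : clearedSumZ q x z I T (q * Z)⁻¹ ε =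
      (q * Z ^ 2)⁻¹ ^ (I.card + T.card) * clearedSumZ q x z I T Z !ε := by
    rw [clearedSumZ, clearedSumZ,
      Finset.prod_congr rfl fun i _ => clearCross_reflect hq hZ (hx i) ε,
      Finset.prod_mul_distrib, Finset.prod_const,
      signSum_eq_prod_mul (B := fun a δ => weightZ q x z I a δ * clearZ q (z a) Z (!ε) δ)
        (fun _ => (q * Z ^ 2)⁻¹) fun a _ δ => by rw [clearZ_reflect hq hZ (hz a)]; ring,
      Finset.prod_const]
    ring
  simp only [clearedDiff, hden, hX, hZ', Fintype.sum_bool, Bool.not_true, Bool.not_false]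
  ring

end reflection

section vanishing

variable {K ι κ : Type*} [Field K] {q : K} {x : ι → K} {z : κ → K}

theorem clearZ_eq_mul_pairKernel {u Z : K} (hq : q ≠ 0) (hu : u ≠ 0) (hZ : Z ≠ 0) (hne : Z ≠ u)
    (hmul : q * (Z * u) ≠ 1) (ε δ : Bool) :
    clearZ q u Z ε δ = (1 - Z / u) * (1 - q * Z * u) * pairKernel q (dualArg q Z u ε δ) := by
  have hsub : u - Z ≠ 0 := sub_ne_zero.2 hne.symm
  have hsub' : Z - u ≠ 0 := sub_ne_zero.2 hne
  have hone : 1 - q * (Z * u) ≠ 0 := sub_ne_zero.2 hmul.symm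
  have hone' : q * Z * u - 1 ≠ 0 := sub_ne_zero.2 fun h => hmul (by rw [← h]; ring)
  cases ε <;> cases δ <;> simp only [clearZ, pairKernel, dualArg]
  · rw [mul_div_assoc', eq_div_iff hone]
    ring
  · rw [mul_div_assoc', eq_div_iff (by rw [one_sub_div hu]; exact div_ne_zero hsub hu)]
    ring
  · rw [mul_div_assoc', eq_div_iff (by rw [one_sub_div hZ]; exact div_ne_zero hsub' hZ)]
    field_simp
    ring
  · have : 1 - (q * (Z * u))⁻¹ = (q * Z * u - 1) / (q * Z * u) := by field_simp
    rw [this]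
    field_simp
    ring

theorem clearZ_self {u : K} (hu : u ≠ 0) (q : K) (ε : Bool) : clearZ q u u ε ε = 0 := by
  cases ε <;> simp [clearZ, hu]

theorem clearZ_self_not {u : K} (hu : u ≠ 0) (q : K) (ε : Bool) :
    clearZ q u u (!ε) ε = -clearZ q u u ε !ε := by
  cases ε <;> simp only [clearZ, mul_div_assoc, div_self hu, Bool.not_true, Bool.not_false] <;> ring

namespace Generic

theorem clearZ_eq_mul_kernZ (g : Generic q x z) {a b : κ} (h : a ≠ b) (ε δ : Bool) :
    clearZ q (z b) (z a) ε δ =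
      (1 - z a / z b) * (1 - q * z a * z b) * kernZ q z a ε b δ :=
  clearZ_eq_mul_pairKernel g.q_ne (g.z_ne b) (g.z_ne a) (g.zz_ne a b h) (g.qzz_mul a b) ε δ

theorem clearCross_false_ne_zero (g : Generic q x z) (a : κ) (i : ι) :
    clearCross q (x i) (z a) false ≠ 0 :=
  mul_ne_zero (g.one_sub_mul_signPow_ne_zero a i false) (g.one_sub_div_signPow_ne_zero a i false)

theorem prod_clearCross (g : Generic q x z) (I : Finset ι) (a : κ) (ε : Bool) :
    ∏ i ∈ I, clearCross q (x i) (z a) ε =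
      (∏ i ∈ I, clearCross q (x i) (z a) false) * weightZ q x z I a ε := by
  cases ε
  · simp [weightZ]
  · rw [weightZ, cond_true, ← Finset.prod_mul_distrib]
    refine Finset.prod_congr rfl fun i _ => ?_
    have hmul := g.one_sub_mul_signPow_ne_zero a i false
    have hdiv := g.one_sub_div_signPow_ne_zero a i false
    have hq := g.q_ne
    simp only [clearCross, crossFactor, signPow, cond_true, cond_false] at hmul hdiv ⊢
    rw [mul_comm (x i) (z a), mul_div_assoc', div_eq_div_iff hq (by positivity)]
    ring

end Generic

variable [LinearOrder κ]

theorem clearedSumZ_apply (g : Generic q x z) (I : Finset ι) {T : Finset κ} {s : κ} (hs : s ∉ T)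
    (ε : Bool) :
    clearedSumZ q x z I T (z s) ε =
      (∏ a ∈ T, (1 - z s / z a) * (1 - q * z s * z a)) *
        (∏ i ∈ I, clearCross q (x i) (z s) false) *
        (weightZ q x z I s ε *
          signSum T (fun a δ => weightZ q x z I a δ * kernZ q z s ε a δ) (kernZ q z)) := by
  rw [clearedSumZ, g.prod_clearCross,
    signSum_eq_prod_mul (B := fun a δ => weightZ q x z I a δ * kernZ q z s ε a δ)
      (fun a => (1 - z s / z a) * (1 - q * z s * z a)) fun a ha δ => ?_]
  · ring
  · rw [g.clearZ_eq_mul_kernZ (ne_of_mem_of_not_mem ha hs).symm]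
    ring

theorem clearedSumZ_pole (g : Generic q x z) (I : Finset ι) {T : Finset κ} {a : κ} (ha : a ∉ T)
    (ε : Bool) :
    clearedSumZ q x z I (insert a T) (z a) ε =
      clearZ q (z a) (z a) ε (!ε) * ((∏ i ∈ I, clearCross q (x i) (z a) false) *
        (weightZ q x z I a ε * weightZ q x z I a !ε) *
        ((∏ b ∈ T, (1 - z a / z b) * (1 - q * z a * z b)) * signSum T (fun b δ =>
          weightZ q x z I b δ * (kernZ q z a ε b δ * kernZ q z a (!ε) b δ)) (kernZ q z))) := by
  have hrest : signSum T (fun b δ => weightZ q x z I b δ * clearZ q (z b) (z a) ε δ *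
      kernZ q z a (!ε) b δ) (kernZ q z) =
      (∏ b ∈ T, (1 - z a / z b) * (1 - q * z a * z b)) * signSum T (fun b δ =>
        weightZ q x z I b δ * (kernZ q z a ε b δ * kernZ q z a (!ε) b δ)) (kernZ q z) := by
    refine signSum_eq_prod_mul _ fun b hb δ => ?_
    rw [g.clearZ_eq_mul_kernZ (ne_of_mem_of_not_mem hb ha).symm]
    ring
  have hself := clearZ_self (g.z_ne a) q ε
  rw [clearedSumZ, g.prod_clearCross, signSum_insert (kernZ_comm q z) ha, Fintype.sum_bool,
    ← hrest]
  cases ε <;> rw [hself] <;> simp only [Bool.not_true, Bool.not_false] <;> ring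

variable [LinearOrder ι]

theorem clearedSumX_apply (g : Generic q x z) (I : Finset ι) {T : Finset κ} {s : κ} (hs : s ∉ T) :
    clearedSumX q x z I T (z s) =
      (∏ i ∈ I, clearCross q (x i) (z s) false) * sumX q x z I (insert s T) := by
  refine signSum_eq_prod_mul _ fun i _ δ => ?_
  have hden : clearCross q (x i) (z s) false =
      (1 - z s * signPow (x i) (!δ)) * (1 - z s * signPow (x i) δ) := by
    cases δ <;> simp [clearCross, signPow, div_eq_mul_inv, mul_comm]
  have hcancel := div_mul_cancel₀ (1 - q * z s * signPow (x i) (!δ))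
    (g.one_sub_mul_signPow_ne_zero s i (!δ))
  rw [weightX, weightX, Finset.prod_insert hs, hden, clearX]
  generalize ∏ l ∈ T, (1 - q * z l * signPow (x i) (!δ)) / (1 - z l * signPow (x i) (!δ)) = P
  linear_combination (-(1 - q * signPow (x i) δ ^ 2) / (1 - signPow (x i) δ ^ 2) * P *
    (1 - z s * signPow (x i) δ)) * hcancel

theorem clearedDiff_apply (g : Generic q x z) (I : Finset ι) {T : Finset κ} {s : κ} (hs : s ∉ T)
    (C : K) :
    clearedDiff q x z I T C (z s) =
      (∏ a ∈ T, (1 - z s / z a) * (1 - q * z s * z a)) *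
        (∏ i ∈ I, clearCross q (x i) (z s) false) *
        (sumX q x z I (insert s T) - C * sumZ q x z I (insert s T)) := by
  rw [clearedDiff, clearedSumX_apply g I hs, sumZ, signSum_insert (kernZ_comm q z) hs]
  simp only [clearedSumZ_apply g I hs, ← Finset.mul_sum]
  ring

theorem sumX_eq_of_clearedDiff_eq_zero (g : Generic q x z) {I : Finset ι} {T : Finset κ} {s : κ}
    (hs : s ∉ T) {C : K} (h : clearedDiff q x z I T C (z s) = 0) :
    sumX q x z I (insert s T) = C * sumZ q x z I (insert s T) := by
  have hT : ∏ a ∈ T, (1 - z s / z a) * (1 - q * z s * z a) ≠ 0 := by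
    refine Finset.prod_ne_zero_iff.2 fun a ha => mul_ne_zero ?_ ?_
    · exact sub_ne_zero.2 fun h => g.zz_ne s a (ne_of_mem_of_not_mem ha hs).symm
        ((div_eq_one_iff_eq (g.z_ne a)).1 h.symm)
    · rw [mul_assoc]
      exact sub_ne_zero.2 (g.qzz_mul s a).symm
  have hI : ∏ i ∈ I, clearCross q (x i) (z s) false ≠ 0 :=
    Finset.prod_ne_zero_iff.2 fun i _ => g.clearCross_false_ne_zero s i
  rw [clearedDiff_apply g I hs] at h
  exact sub_eq_zero.1 ((mul_eq_zero_iff_left (mul_ne_zero hT hI)).1 h)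

theorem clearedDiff_zero (q : K) (x : ι → K) (z : κ → K) (I : Finset ι) (T : Finset κ) (C : K) :
    clearedDiff q x z I T C 0 =
      sumX q x z I T - C * ((1 + q ^ T.card * q⁻¹ ^ I.card) * sumZ q x z I T) := by
  have hX : clearedSumX q x z I T 0 = sumX q x z I T :=
    signSum_congr fun i _ δ => by simp [clearX]
  have hZfalse : clearedSumZ q x z I T 0 false = sumZ q x z I T := by
    rw [clearedSumZ, sumZ, signSum_congr (B := weightZ q x z I) fun a _ δ => ?_]
    · simp [clearCross]
    · cases δ <;> simp [clearZ]
  have hZtrue : clearedSumZ q x z I T 0 true = q ^ T.card * q⁻¹ ^ I.card * sumZ q x z I T := by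
    rw [clearedSumZ, sumZ, signSum_eq_prod_mul (fun _ => q) fun a _ δ => ?_]
    · simp only [clearCross, Finset.prod_const, cond_true, mul_zero, zero_mul, zero_div, sub_zero,
        one_mul, one_div]
      ring
    · cases δ <;> simp [clearZ, mul_comm]
  simp only [clearedDiff, hX, Fintype.sum_bool, hZfalse, hZtrue, zero_div, mul_zero, zero_mul,
    sub_zero, mul_one, Finset.prod_const_one]
  ring

-- Exchanging the signs of `Z` and `z a` negates the only surviving factor `clearZ` at `Z = z a`.
theorem clearedDiff_pole (g : Generic q x z) (I : Finset ι) {T : Finset κ} {a : κ} (ha : a ∈ T)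
    (C : K) : clearedDiff q x z I T C (z a) = 0 := by
  obtain ⟨T, haT, rfl⟩ : ∃ T', a ∉ T' ∧ insert a T' = T :=
    ⟨T.erase a, Finset.notMem_erase a T, Finset.insert_erase ha⟩
  have hden : ∏ b ∈ insert a T, (1 - z a / z b) * (1 - q * z a * z b) = 0 :=
    Finset.prod_eq_zero (Finset.mem_insert_self a T) (by simp [g.z_ne a])
  have hflip := clearZ_self_not (g.z_ne a) q true
  simp only [clearedDiff, hden, Fintype.sum_bool, clearedSumZ_pole g I haT, Bool.not_true,
    Bool.not_false, mul_comm (kernZ q z a false _ _)] at hflip ⊢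
  rw [hflip]
  ring

end vanishing

section collision

variable {K ι κ : Type*} [Field K] {q : K} {x : ι → K} {z : κ → K}

theorem clearCross_signPow_false {u : K} (hu : u ≠ 0) (q : K) (ε : Bool) :
    clearCross q u (signPow u ε) false = 0 := by
  cases ε <;> simp [clearCross, signPow, hu]

theorem clearCross_signPow_true {u : K} (hu : u ≠ 0) (q : K) (ε : Bool) :
    clearCross q u (signPow u ε) true = (1 - q) * (1 - q * signPow u ε ^ 2) / q := by
  cases ε <;> simp only [clearCross, signPow, cond_true, cond_false] <;> field_simp

theorem clearX_signPow_not {u : K} (hu : u ≠ 0) (q : K) (ε : Bool) :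
    clearX q u (signPow u ε) (!ε) = 0 := by
  cases ε <;> simp [clearX, signPow, hu]

theorem clearX_signPow {u : K} (hu : u ≠ 0) (q : K) (ε : Bool) :
    clearX q u (signPow u ε) ε = (1 - q) * (1 - signPow u ε ^ 2) := by
  have := signPow_ne_zero hu ε
  rw [clearX, signPow_not]
  field_simp

theorem crossFactor_mul_clearZ {u y : K} (hq : q ≠ 0) (hu : u ≠ 0) (hy : y ≠ 0)
    (hmul : 1 - u * y ≠ 0) (hdiv : 1 - u / y ≠ 0) :
    crossFactor q y u * clearZ q u y true true = clearZ q u y true false := by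
  rw [mul_comm u y] at hmul
  simp only [crossFactor, clearZ]
  rw [div_mul_eq_mul_div, div_eq_iff (by positivity)]
  field_simp
  ring

theorem den_mul_weightX_factor {u y : K} (hu : u ≠ 0) (hy : y ≠ 0) (hdiv : 1 - u / y ≠ 0) :
    (1 - y / u) * (1 - q * y * u) * ((1 - q * u * y⁻¹) / (1 - u * y⁻¹)) =
      clearZ q u y true false := by
  rw [div_eq_mul_inv] at hdiv
  rw [mul_div_assoc', div_eq_iff hdiv, clearZ]
  field_simp
  ring

theorem Generic.clearX_mul_kernX (g : Generic q x z) {i j : ι} (h : i ≠ j) (ε δ : Bool) :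
    clearX q (x j) (signPow (x i) ε) δ * kernX q x i ε j δ =
      q * clearCross q (x j) (signPow (x i) ε) true := by
  have hq := g.q_ne
  have hne := sub_ne_zero.2 (g.signPow_mul_signPow_ne_one h ε δ).symm
  rw [clearX, kernX, pairKernel, mul_div_assoc', div_eq_iff hne, clearCross, cond_true,
    mul_div_cancel₀ _ hq]
  cases δ <;> simp only [signPow, cond_true, cond_false, Bool.not_true, Bool.not_false] <;> ring

variable [LinearOrder ι]

theorem prod_den_mul_clearedSumX_signPow (g : Generic q x z) {I : Finset ι} {i : ι} (hi : i ∉ I)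
    (T : Finset κ) (ε : Bool) :
    (∏ a ∈ T, (1 - signPow (x i) ε / z a) * (1 - q * signPow (x i) ε * z a)) *
        clearedSumX q x z (insert i I) T (signPow (x i) ε) =
      (1 - q) * (1 - q * signPow (x i) ε ^ 2) *
        (∏ a ∈ T, clearZ q (z a) (signPow (x i) ε) true false) *
        (q ^ I.card * ∏ j ∈ I, clearCross q (x j) (signPow (x i) ε) true) * sumX q x z I T := by
  have hx := g.x_ne i
  have hy := signPow_ne_zero hx ε
  have hsq : 1 - signPow (x i) ε ^ 2 ≠ 0 := sub_ne_zero.2 (g.signPow_sq_ne_one i ε).symm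
  have hrest : signSum I (fun j δ => weightX q x z T j δ * clearX q (x j) (signPow (x i) ε) δ *
      kernX q x i ε j δ) (kernX q x) =
      (q ^ I.card * ∏ j ∈ I, clearCross q (x j) (signPow (x i) ε) true) * sumX q x z I T := by
    rw [← Finset.prod_const, ← Finset.prod_mul_distrib]
    refine signSum_eq_prod_mul _ fun j hj δ => ?_
    rw [mul_assoc, g.clearX_mul_kernX (ne_of_mem_of_not_mem hj hi).symm, mul_comm]
  have hsum : clearedSumX q x z (insert i I) T (signPow (x i) ε) =
      weightX q x z T i ε * clearX q (x i) (signPow (x i) ε) ε *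
        ((q ^ I.card * ∏ j ∈ I, clearCross q (x j) (signPow (x i) ε) true) * sumX q x z I T) := by
    have hzero := clearX_signPow_not hx q ε
    rw [clearedSumX, signSum_insert (kernX_comm q x) hi, Fintype.sum_bool, ← hrest]
    cases ε <;> simp only [Bool.not_true, Bool.not_false] at hzero <;> rw [hzero] <;> ring
  have hW : ∏ a ∈ T, clearZ q (z a) (signPow (x i) ε) true false =
      (∏ a ∈ T, (1 - signPow (x i) ε / z a) * (1 - q * signPow (x i) ε * z a)) *
        ∏ a ∈ T, (1 - q * z a * (signPow (x i) ε)⁻¹) / (1 - z a * (signPow (x i) ε)⁻¹) := by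
    rw [← Finset.prod_mul_distrib]
    exact Finset.prod_congr rfl fun a _ =>
      (den_mul_weightX_factor (g.z_ne a) hy (g.one_sub_div_signPow_ne_zero a i ε)).symm
  have hcancel := div_mul_cancel₀ (1 - q * signPow (x i) ε ^ 2) hsq
  rw [hsum, hW, clearX_signPow hx, weightX, signPow_not]
  generalize ∏ a ∈ T, (1 - q * z a * (signPow (x i) ε)⁻¹) / (1 - z a * (signPow (x i) ε)⁻¹) = P
  generalize ∏ a ∈ T, (1 - signPow (x i) ε / z a) * (1 - q * signPow (x i) ε * z a) = D
  generalize ∏ j ∈ I, clearCross q (x j) (signPow (x i) ε) true = R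
  linear_combination (1 - q) * D * P * (q ^ I.card * R) * sumX q x z I T * hcancel

variable [LinearOrder κ]

theorem clearedSumZ_signPow (g : Generic q x z) {I : Finset ι} {i : ι} (hi : i ∉ I)
    (T : Finset κ) (ε : Bool) :
    ∑ δ, clearedSumZ q x z (insert i I) T (signPow (x i) ε) δ =
      (1 - q) * (1 - q * signPow (x i) ε ^ 2) / q *
        (∏ j ∈ I, clearCross q (x j) (signPow (x i) ε) true) *
        (∏ a ∈ T, clearZ q (z a) (signPow (x i) ε) true false) * sumZ q x z I T := by
  have hx := g.x_ne i
  have hsum : signSum T (fun a δ => weightZ q x z (insert i I) a δ *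
      clearZ q (z a) (signPow (x i) ε) true δ) (kernZ q z) =
      (∏ a ∈ T, clearZ q (z a) (signPow (x i) ε) true false) * sumZ q x z I T := by
    refine signSum_eq_prod_mul _ fun a _ δ => ?_
    rw [weightZ_insert q x z hi, ← crossFactor_signPow q (x i) (z a) ε]
    cases δ
    · rw [cond_false, one_mul, mul_comm]
    · rw [cond_true, mul_right_comm, crossFactor_mul_clearZ g.q_ne (g.z_ne a)
        (signPow_ne_zero hx ε) (g.one_sub_mul_signPow_ne_zero a i ε)
        (g.one_sub_div_signPow_ne_zero a i ε)]
  simp only [clearedSumZ, Fintype.sum_bool, Finset.prod_insert hi, clearCross_signPow_false hx,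
    clearCross_signPow_true hx, hsum]
  ring

theorem clearedDiff_signPow (g : Generic q x z) {I : Finset ι} {i : ι} (hi : i ∈ I)
    (T : Finset κ) {C : K} (ε : Bool)
    (h : q ^ I.card * sumX q x z (I.erase i) T = C * sumZ q x z (I.erase i) T) :
    clearedDiff q x z I T C (signPow (x i) ε) = 0 := by
  obtain ⟨J, hiJ, rfl⟩ : ∃ J, i ∉ J ∧ insert i J = I :=
    ⟨I.erase i, Finset.notMem_erase i I, Finset.insert_erase hi⟩
  rw [Finset.erase_insert hiJ, Finset.card_insert_of_notMem hiJ] at h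
  have hq := g.q_ne
  rw [clearedDiff, prod_den_mul_clearedSumX_signPow g hiJ, clearedSumZ_signPow g hiJ]
  field_simp
  linear_combination (1 - q) * (1 - q * signPow (x i) ε ^ 2) *
    (∏ a ∈ T, clearZ q (z a) (signPow (x i) ε) true false) *
    (∏ j ∈ J, clearCross q (x j) (signPow (x i) ε) true) * h

end collision

section interpolation

variable {K ι κ : Type*} [Field K] {q : K} {x : ι → K} {z : κ → K}

/-- The points at which the cleared difference vanishes: the numbers `x i`, `(x i)⁻¹`, `z a` and
`(q * z a)⁻¹`. -/
def root (q : K) (x : ι → K) (z : κ → K) : (ι × Bool) ⊕ (κ × Bool) → K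
  | .inl (i, ε) => signPow (x i) ε
  | .inr (a, ε) => bif ε then (q * z a)⁻¹ else z a

theorem eq_signPow_not_of_signPow_eq_inv {u v : K} {ε : Bool} (h : signPow u ε = v⁻¹) :
    v = signPow u (!ε) := by
  rw [signPow_not, h, inv_inv]

namespace Generic

theorem signPow_injective (g : Generic q x z) :
    Function.Injective fun p : ι × Bool => signPow (x p.1) p.2 := by
  rintro ⟨i, ε⟩ ⟨j, δ⟩ (h : signPow (x i) ε = signPow (x j) δ)
  obtain rfl | hij := eq_or_ne i j
  · obtain rfl | rfl := Bool.eq_or_eq_not δ ε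
    · rfl
    · rw [signPow_not, ← mul_eq_one_iff_eq_inv₀ (signPow_ne_zero (g.x_ne i) ε), ← pow_two] at h
      exact (g.signPow_sq_ne_one i ε h).elim
  · refine (g.signPow_mul_signPow_ne_one hij ε (!δ) ?_).elim
    rw [h, signPow_not, mul_inv_cancel₀ (signPow_ne_zero (g.x_ne j) δ)]

theorem mul_z_ne_signPow (g : Generic q x z) (a : κ) (i : ι) (ε : Bool) :
    q * z a ≠ signPow (x i) ε := by
  cases ε
  · exact g.qzx_ne a i
  · rw [signPow, cond_true, ne_eq, ← mul_eq_one_iff_eq_inv₀ (g.x_ne i), mul_assoc]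
    exact g.qzx_mul a i

theorem mul_x_ne_signPow (g : Generic q x z) (i j : ι) (ε : Bool) :
    q * x i ≠ signPow (x j) ε := by
  cases ε
  · exact g.qxx_ne i j
  · rw [signPow, cond_true, ne_eq, ← mul_eq_one_iff_eq_inv₀ (g.x_ne j), mul_assoc]
    exact g.qxx_mul i j

theorem z_ne_inv (g : Generic q x z) (a b : κ) : z a ≠ (q * z b)⁻¹ := by
  rw [ne_eq, ← mul_eq_one_iff_eq_inv₀ (mul_ne_zero g.q_ne (g.z_ne b)), mul_left_comm]
  exact g.qzz_mul a b

theorem root_injective (g : Generic q x z) : Function.Injective (root q x z) := by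
  have hne (i ε a δ) : root q x z (.inl (i, ε)) ≠ root q x z (.inr (a, δ)) := by
    cases δ
    · exact (g.ne_signPow a i ε).symm
    · exact fun h => g.mul_z_ne_signPow a i (!ε) (eq_signPow_not_of_signPow_eq_inv h)
  rintro (⟨i, ε⟩ | ⟨a, ε⟩) (⟨j, δ⟩ | ⟨b, δ⟩) h
  · exact congrArg Sum.inl (g.signPow_injective h)
  · exact (hne _ _ _ _ h).elim
  · exact (hne _ _ _ _ h.symm).elim
  · cases ε <;> cases δ
    · rw [g.injective_z h]
    · exact (g.z_ne_inv a b h).elim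
    · exact (g.z_ne_inv b a h.symm).elim
    · rw [g.injective_z (mul_left_cancel₀ g.q_ne (inv_injective h))]

theorem root_ne_zero (g : Generic q x z) (r : (ι × Bool) ⊕ (κ × Bool)) : root q x z r ≠ 0 := by
  rcases r with ⟨i, ε⟩ | ⟨a, _ | _⟩
  · exact signPow_ne_zero (g.x_ne i) ε
  · exact g.z_ne a
  · exact inv_ne_zero (mul_ne_zero g.q_ne (g.z_ne a))

theorem root_ne_inv (g : Generic q x z) (r : (ι × Bool) ⊕ (κ × Bool)) (i : ι) :
    root q x z r ≠ (q * x i)⁻¹ := by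
  intro h
  rcases r with ⟨j, ε⟩ | ⟨a, _ | _⟩
  · exact g.mul_x_ne_signPow i j (!ε) (eq_signPow_not_of_signPow_eq_inv h)
  · refine g.qzx_mul a i ?_
    rwa [root, cond_false, ← mul_eq_one_iff_eq_inv₀ (mul_ne_zero g.q_ne (g.x_ne i)),
      mul_left_comm] at h
  · exact g.zx_ne a i (mul_left_cancel₀ g.q_ne (inv_injective h))

end Generic

variable [LinearOrder ι] [LinearOrder κ]

theorem clearedDiff_root (g : Generic q x z) {I : Finset ι} {T : Finset κ} {C : K}
    (h : ∀ i ∈ I, q ^ I.card * sumX q x z (I.erase i) T = C * sumZ q x z (I.erase i) T)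
    {r : (ι × Bool) ⊕ (κ × Bool)} (hr : r ∈ (I ×ˢ Finset.univ).disjSum (T ×ˢ Finset.univ)) :
    clearedDiff q x z I T C (root q x z r) = 0 := by
  rcases r with ⟨i, ε⟩ | ⟨a, ε⟩
  · have hi : i ∈ I := by simpa using hr
    exact clearedDiff_signPow g hi T ε (h i hi)
  · have ha : a ∈ T := by simpa using hr
    have hpole := clearedDiff_pole g I ha C
    cases ε
    · exact hpole
    · rw [root, cond_true, clearedDiff_reflect g.q_ne (g.z_ne a) g.x_ne g.z_ne, hpole, mul_zero]

theorem clearedDiff_eq_zero (g : Generic q x z) {I : Finset ι} {T : Finset κ} {C p : K}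
    (h : ∀ i ∈ I, q ^ I.card * sumX q x z (I.erase i) T = C * sumZ q x z (I.erase i) T)
    (hp : ∀ r, root q x z r ≠ p) (hp0 : clearedDiff q x z I T C p = 0) (Z : K) :
    clearedDiff q x z I T C Z = 0 := by
  classical
  let roots := ((I ×ˢ Finset.univ).disjSum (T ×ˢ Finset.univ)).map ⟨root q x z, g.root_injective⟩
  have hmem : p ∉ roots := by
    rw [Finset.mem_map]
    exact fun ⟨r, _, hr⟩ => hp r hr
  refine (isPolyFun_clearedDiff q x z I T C).eq_zero (s := insert p roots) ?_ ?_ Z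
  · rw [Finset.card_insert_of_notMem hmem]
    simp only [roots, Finset.card_map, Finset.card_disjSum, Finset.card_product, Finset.card_univ,
      Fintype.card_bool]
    omega
  · rintro y hy
    obtain rfl | hy := Finset.mem_insert.1 hy
    · exact hp0
    · obtain ⟨r, hr, rfl⟩ := Finset.mem_map.1 hy
      exact clearedDiff_root g h hr

theorem clearedDiff_eq_zero_of_nonempty (g : Generic q x z) {I : Finset ι} (hI : I.Nonempty)
    {T : Finset κ} {C : K}
    (h : ∀ i ∈ I, q ^ I.card * sumX q x z (I.erase i) T = C * sumZ q x z (I.erase i) T) (Z : K) :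
    clearedDiff q x z I T C Z = 0 := by
  obtain ⟨i, hi⟩ := hI
  refine clearedDiff_eq_zero g h (fun r => g.root_ne_inv r i) ?_ Z
  rw [clearedDiff_reflect g.q_ne (g.x_ne i) g.x_ne g.z_ne,
    show x i = signPow (x i) false from rfl, clearedDiff_signPow g hi T false (h i hi), mul_zero]

end interpolation

section qPochInt

variable {K : Type*} [Field K]

theorem qPoch_zero (a q : K) : qPoch a q 0 = 1 :=
  Finset.prod_range_zero _

theorem qPoch_succ (a q : K) (n : ℕ) : qPoch a q (n + 1) = qPoch a q n * (1 - a * q ^ n) :=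
  Finset.prod_range_succ _ _

theorem qPoch_succ' (a q : K) (n : ℕ) : qPoch a q (n + 1) = (1 - a) * qPoch (a * q) q n := by
  simp only [qPoch, Finset.prod_range_succ', pow_zero, mul_one, mul_comm (1 - a), pow_succ',
    mul_assoc]

theorem qPochInt_natCast (a q : K) (n : ℕ) : qPochInt a q n = qPoch a q n :=
  rfl

theorem qPochInt_zero (a q : K) : qPochInt a q 0 = 1 :=
  qPoch_zero a q

theorem qPochInt_neg_natCast (a q : K) : ∀ n : ℕ,
    qPochInt a q (-n) = (qPoch (a * q ^ (-(n : ℤ))) q n)⁻¹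
  | 0 => by simp [qPochInt_zero, qPoch_zero]
  | n + 1 => by push_cast; rfl

theorem qPochInt_add_one {a q : K} (hq : q ≠ 0) {N : ℤ} (h : a * q ^ N ≠ 1) :
    qPochInt a q (N + 1) = (1 - a * q ^ N) * qPochInt a q N := by
  obtain n | n := N
  · rw [Int.ofNat_eq_natCast, ← Nat.cast_succ, qPochInt_natCast, qPochInt_natCast, qPoch_succ,
      zpow_natCast, mul_comm]
  · have hN : Int.negSucc n + 1 = -n := by omega
    have hshift : a * q ^ Int.negSucc n * q = a * q ^ (-n : ℤ) := by
      rw [mul_assoc, ← zpow_add_one₀ hq, hN]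
    rw [hN, qPochInt_neg_natCast, ← Int.neg_ofNat_succ, qPochInt_neg_natCast, Int.neg_ofNat_succ,
      qPoch_succ', hshift, mul_inv, mul_inv_cancel_left₀ (sub_ne_zero.2 h.symm)]

/-- The constant relating the two sides of the multiplicity-one duality. -/
def dualityConst (q : K) (n t : ℕ) : K :=
  q ^ ((n : ℤ) * t - t.choose 2) * qPochInt (-q) q (n - t)

theorem dualityConst_zero (q : K) : dualityConst q 0 0 = 1 := by
  simp [dualityConst, qPochInt_zero]

theorem dualityConst_succ_succ {q : K} (hq : q ≠ 0) (n t : ℕ) :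
    dualityConst q (n + 1) (t + 1) = q ^ (n + 1) * dualityConst q n t := by
  have hexp : ((n + 1 : ℕ) : ℤ) * (t + 1 : ℕ) - (t + 1).choose 2 =
      (n + 1 : ℕ) + ((n : ℤ) * t - t.choose 2) := by
    rw [Nat.choose_succ_succ' t 1, Nat.choose_one_right]
    push_cast
    ring
  have hidx : ((n + 1 : ℕ) : ℤ) - (t + 1 : ℕ) = n - t := by push_cast; ring
  rw [dualityConst, dualityConst, hexp, hidx, zpow_add₀ hq, zpow_natCast, mul_assoc]

theorem dualityConst_succ {q : K} (hq : q ≠ 0) (h : ∀ j : ℤ, q ^ j ≠ -1) (n t : ℕ) :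
    dualityConst q n (t + 1) * (1 + q ^ t * q⁻¹ ^ n) = dualityConst q n t := by
  have hexp : (n : ℤ) * t - t.choose 2 =
      (n : ℤ) * (t + 1 : ℕ) - (t + 1).choose 2 + (t - n) := by
    rw [Nat.choose_succ_succ' t 1, Nat.choose_one_right]
    push_cast
    ring
  have hidx : (n : ℤ) - t = n - (t + 1 : ℕ) + 1 := by push_cast; ring
  have hpow : -q * q ^ ((n : ℤ) - (t + 1 : ℕ)) = -q ^ ((n : ℤ) - t) := by
    rw [hidx, zpow_add_one₀ hq, neg_mul, mul_comm q]
  have hne : -q * q ^ ((n : ℤ) - (t + 1 : ℕ)) ≠ 1 := by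
    rw [hpow, ne_eq, neg_eq_iff_eq_neg]
    exact h _
  have hfactor : q ^ ((t : ℤ) - n) * (1 + q ^ ((n : ℤ) - t)) = 1 + q ^ t * q⁻¹ ^ n := by
    rw [mul_add, ← zpow_add₀ hq, mul_one, zpow_sub₀ hq, zpow_natCast, zpow_natCast, inv_pow]
    simp [add_comm, div_eq_mul_inv]
  rw [dualityConst, dualityConst, hexp, hidx, qPochInt_add_one hq hne, hpow, zpow_add₀ hq,
    ← hfactor]
  ring

end qPochInt

section duality

variable {K ι κ : Type*} [Field K] [LinearOrder ι] [LinearOrder κ] {q : K} {x : ι → K} {z : κ → K}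

theorem sumX_empty (g : Generic q x z) (T : Finset κ) :
    sumX q x z ∅ T = dualityConst q 0 T.card * sumZ q x z ∅ T := by
  induction T using Finset.induction_on with
  | empty => simp [sumX, sumZ, dualityConst_zero]
  | insert s T hs ih =>
    rw [Finset.card_insert_of_notMem hs]
    refine sumX_eq_of_clearedDiff_eq_zero g hs
      (clearedDiff_eq_zero g (p := 0) (by simp) g.root_ne_zero ?_ _)
    rw [clearedDiff_zero, ih, ← dualityConst_succ g.q_ne g.q_zpow, Finset.card_empty]
    ring

theorem sumX_eq_sumZ (g : Generic q x z) (I : Finset ι) (T : Finset κ) :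
    sumX q x z I T = dualityConst q I.card T.card * sumZ q x z I T := by
  induction hn : I.card generalizing I T with
  | zero =>
    obtain rfl := Finset.card_eq_zero.1 hn
    exact sumX_empty g T
  | succ n ih =>
    have hI : I.Nonempty := Finset.card_pos.1 (by omega)
    have vanishing (T : Finset κ) (Z : K) :
        clearedDiff q x z I T (dualityConst q (n + 1) (T.card + 1)) Z = 0 := by
      refine clearedDiff_eq_zero_of_nonempty g hI (fun i hi => ?_) Z
      rw [hn, dualityConst_succ_succ g.q_ne, mul_assoc,
        ih _ T (by rw [Finset.card_erase_of_mem hi, hn, Nat.add_sub_cancel])]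
    obtain rfl | ⟨s, hs⟩ := T.eq_empty_or_nonempty
    · have hzero := vanishing ∅ 0
      rwa [clearedDiff_zero, sub_eq_zero, ← mul_assoc, hn, Finset.card_empty,
        dualityConst_succ g.q_ne g.q_zpow] at hzero
    · rw [← Finset.insert_erase hs, Finset.card_insert_of_notMem (Finset.notMem_erase s T)]
      exact sumX_eq_of_clearedDiff_eq_zero g (Finset.notMem_erase s T) (vanishing _ _)

end duality

/-! ### Geometric progressions -/

section qPoch

variable {K : Type*} [Field K]

theorem qPoch_add (a q : K) (m n : ℕ) :
    qPoch a q (m + n) = qPoch a q m * qPoch (a * q ^ m) q n := by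
  simp only [qPoch, Finset.prod_range_add, pow_add, mul_assoc]

theorem qPoch_ne_zero {a q : K} {n : ℕ} (h : ∀ i < n, a * q ^ i ≠ 1) : qPoch a q n ≠ 0 :=
  Finset.prod_ne_zero_iff.2 fun i hi => sub_ne_zero.2 (h i (Finset.mem_range.1 hi)).symm

-- The `k + k` factors are those with even and those with odd exponent.
theorem qPoch_add_self (q c : K) (k : ℕ) :
    qPoch (q * c) q (k + k) =
      qPoch (q * c) (q ^ 2) k * ∏ e ∈ Finset.range k, (1 - q ^ (2 + e + e) * c) := by
  induction k with
  | zero => simp [qPoch]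
  | succ k ih =>
    rw [add_add_add_comm, ← add_assoc, qPoch_succ, qPoch_succ, ih, qPoch_succ,
      Finset.prod_range_succ]
    ring

theorem qPoch_div_qPoch_comm {q c : K} (h : ∀ j, q ^ j * c ≠ 1) (k l : ℕ) :
    qPoch (q ^ (l + 1) * c) q k / qPoch (q * c) q k =
      qPoch (q ^ (k + 1) * c) q l / qPoch (q * c) q l := by
  have hne (n : ℕ) : qPoch (q * c) q n ≠ 0 :=
    qPoch_ne_zero fun i _ hi => h (i + 1) (by rw [← hi]; ring)
  have hshift (n : ℕ) : q ^ (n + 1) * c = q * c * q ^ n := by ring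
  have hadd := qPoch_add (q * c) q k l
  rw [add_comm, qPoch_add] at hadd
  rw [div_eq_div_iff (hne k) (hne l), hshift, hshift]
  linear_combination hadd

end qPoch

theorem prod_Ico_eq_div {K : Type*} [CommGroupWithZero K] {f F : ℕ → K} {a b : ℕ} (hab : a ≤ b)
    (hF : ∀ i, a ≤ i → i ≤ b → F i ≠ 0)
    (h : ∀ i, a ≤ i → i < b → f i = F (i + 1) / F i) : ∏ i ∈ Finset.Ico a b, f i = F b / F a := by
  induction b, hab using Nat.le_induction with
  | base => simp [div_self (hF a le_rfl le_rfl)]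
  | succ b hab ih =>
    rw [Finset.prod_Ico_succ_top hab, ih (fun i h₁ h₂ => hF i h₁ (by omega))
      (fun i h₁ h₂ => h i h₁ (by omega)), h b hab (by omega), mul_comm,
      div_mul_div_cancel₀ (hF b hab (by omega))]

section row

variable {K : Type*} [Field K]

theorem prod_pairKernel_false_true {q u v : K} (hq : q ≠ 0) (hv : v ≠ 0) {m e : ℕ}
    (h : ∀ f ≤ m, q ^ f * v ≠ q ^ (e + 1) * u) :
    ∏ f ∈ Finset.range m, pairKernel q (dualArg q (q ^ e * u) (q ^ f * v) false true) =
      q ^ m * (v - q ^ (e + 1) * u) / (q ^ m * v - q ^ (e + 1) * u) := by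
  rw [Finset.range_eq_Ico, prod_Ico_eq_div (F := fun f => q ^ f / (q ^ f * v - q ^ (e + 1) * u))
    (Nat.zero_le m)]
  · rw [pow_zero, one_mul, one_div, div_inv_eq_mul]
    ring
  · exact fun i _ hi => div_ne_zero (pow_ne_zero _ hq) (sub_ne_zero.2 (h i hi))
  · intro f _ hf
    have hf₀ := sub_ne_zero.2 (h f (by omega))
    have hf₁ := sub_ne_zero.2 (h (f + 1) (by omega))
    have hfv : q ^ f * v ≠ 0 := mul_ne_zero (pow_ne_zero _ hq) hv
    have hshift : q ^ (f + 1) * v - q ^ (e + 1) * u = q * (q ^ f * v - q ^ e * u) := by ring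
    rw [hshift] at hf₁ ⊢
    have hfe := right_ne_zero_of_mul hf₁
    simp only [pairKernel, dualArg]
    rw [mul_div_assoc', one_sub_div hfv, one_sub_div hfv]
    field_simp [hf₀]
    ring

theorem prod_pairKernel_false_false {q u v : K} {a b e : ℕ} (hab : a ≤ b)
    (h : ∀ j, q ^ j * (u * v) ≠ 1) :
    ∏ f ∈ Finset.Ico a b, pairKernel q (dualArg q (q ^ e * u) (q ^ f * v) false false) =
      (1 - q ^ (1 + e + b) * (u * v)) / (1 - q ^ (1 + e + a) * (u * v)) := by
  refine prod_Ico_eq_div (F := fun f => 1 - q ^ (1 + e + f) * (u * v)) hab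
    (fun i _ _ => sub_ne_zero.2 (h _).symm) fun f _ _ => ?_
  simp only [pairKernel, dualArg]
  congr 1 <;> ring

theorem prod_pairKernel_true_true {q u v : K} (hq : q ≠ 0) (hu : u ≠ 0) (hv : v ≠ 0) {m e : ℕ}
    (h : ∀ j, q ^ j * (u * v) ≠ 1) :
    ∏ f ∈ Finset.range m, pairKernel q (dualArg q (q ^ e * u) (q ^ f * v) true true) =
      q ^ m * (1 - q ^ e * (u * v)) / (1 - q ^ (e + m) * (u * v)) := by
  have hF (i) : 1 - q ^ (e + i) * (u * v) ≠ 0 := sub_ne_zero.2 (h _).symm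
  rw [Finset.range_eq_Ico, prod_Ico_eq_div (F := fun f => q ^ f / (1 - q ^ (e + f) * (u * v)))
    (Nat.zero_le m)]
  · rw [pow_zero, add_zero, one_div, div_inv_eq_mul]
    ring
  · exact fun i _ _ => div_ne_zero (pow_ne_zero _ hq) (hF i)
  · intro f _ _
    have hf₀ := hF f
    have hf₁ := hF (f + 1)
    have hp : q ^ (e + f) * (u * v) ≠ 0 := by positivity
    have harg : (q * (q ^ e * u * (q ^ f * v)))⁻¹ = (q * (q ^ (e + f) * (u * v)))⁻¹ := by ring
    have hnum : q ^ (e + (f + 1)) * (u * v) = q * (q ^ (e + f) * (u * v)) := by ring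
    simp only [pairKernel, dualArg]
    rw [hnum] at hf₁
    rw [harg, hnum]
    generalize q ^ (e + f) * (u * v) = p at hf₀ hf₁ hp ⊢
    have hqp := mul_ne_zero hq hp
    rw [← div_eq_mul_inv, one_sub_div hqp, ← one_div, one_sub_div hqp,
      div_div_div_cancel_right₀ hqp, ← neg_div_neg_eq, neg_sub, neg_sub, pow_succ]
    field_simp

theorem prod_pairKernel_true_false {q u v : K} (hq : q ≠ 0) (hu : u ≠ 0) {a b e : ℕ} (hab : a ≤ b)
    (h : ∀ f, a ≤ f → q ^ e * u ≠ q ^ f * v) :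
    ∏ f ∈ Finset.Ico a b, pairKernel q (dualArg q (q ^ e * u) (q ^ f * v) true false) =
      (q ^ e * u - q ^ b * v) / (q ^ e * u - q ^ a * v) := by
  refine prod_Ico_eq_div (F := fun f => q ^ e * u - q ^ f * v) hab
    (fun i hi _ => sub_ne_zero.2 (h i hi)) fun f _ _ => ?_
  have heu : q ^ e * u ≠ 0 := mul_ne_zero (pow_ne_zero _ hq) hu
  simp only [pairKernel, dualArg]
  rw [mul_div_assoc', one_sub_div heu, one_sub_div heu, div_div_div_cancel_right₀ heu]
  ring

/-- The product of the two-point weights of the element `q ^ e * u` of one block, with sign `ε`,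
with the elements `q ^ f * v` of another block of size `k`, where those with `f < a` are negative,
those with `b ≤ f` are positive, and those in between are left out. -/
def rowProd (q u v : K) (a b k e : ℕ) (ε : Bool) : K :=
  (∏ f ∈ Finset.range a, pairKernel q (dualArg q (q ^ e * u) (q ^ f * v) ε true)) *
    ∏ f ∈ Finset.Ico b k, pairKernel q (dualArg q (q ^ e * u) (q ^ f * v) ε false)

/-- The factor of the coefficient `c_m` that belongs to an ordered pair of blocks. -/
def shiftCoeff (q u v : K) (k m : ℕ) : K :=
  (qPoch (q ^ (-(k : ℤ)) * (u / v)) q m / qPoch (q * (u / v)) q m) *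
    (qPoch (u * v) q m / qPoch (q ^ (1 + k) * (u * v)) q m)

theorem shiftCoeff_zero (q u v : K) (k : ℕ) : shiftCoeff q u v k 0 = 1 := by
  simp [shiftCoeff, qPoch_zero]

theorem shiftCoeff_succ {q u v : K} (hq : q ≠ 0) (hv : v ≠ 0) {k m : ℕ}
    (hne : v ≠ q ^ (m + 1) * u) (hmul : q ^ (1 + m + k) * (u * v) ≠ 1) :
    shiftCoeff q u v k (m + 1) *
        (q ^ k * (v - q ^ (m + 1) * u) * (1 - q ^ (1 + m + k) * (u * v))) =
      shiftCoeff q u v k m * ((q ^ k * v - q ^ m * u) * (1 - q ^ m * (u * v))) := by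
  have hne' := sub_ne_zero.2 hne
  have hmul' := sub_ne_zero.2 hmul.symm
  have hnum : 1 - q ^ (-(k : ℤ)) * (u / v) * q ^ m = (q ^ k * v - q ^ m * u) / (q ^ k * v) := by
    rw [zpow_neg, zpow_natCast]
    field_simp
  have hden : 1 - q * (u / v) * q ^ m = (v - q ^ (m + 1) * u) / v := by
    field_simp
    ring
  have hmul_den : q ^ (1 + k) * (u * v) * q ^ m = q ^ (1 + m + k) * (u * v) := by ring
  simp only [shiftCoeff, qPoch_succ, hnum, hden, hmul_den, mul_comm (u * v) (q ^ m),
    ← div_mul_div_comm]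
  generalize q ^ (1 + m + k) * (u * v) = p at *
  generalize v - q ^ (m + 1) * u = w at *
  field_simp

theorem rowProd_false {q u v : K} (hq : q ≠ 0) (hv : v ≠ 0) {a b k e : ℕ} (hbk : b ≤ k)
    (hne : ∀ f ≤ a, q ^ f * v ≠ q ^ (e + 1) * u) (hmul : ∀ j, q ^ j * (u * v) ≠ 1) :
    rowProd q u v a b k e false =
      q ^ a * (v - q ^ (e + 1) * u) / (q ^ a * v - q ^ (e + 1) * u) *
        ((1 - q ^ (1 + e + k) * (u * v)) / (1 - q ^ (1 + e + b) * (u * v))) := by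
  rw [rowProd, prod_pairKernel_false_true hq hv hne, prod_pairKernel_false_false hbk hmul]

theorem rowProd_true {q u v : K} (hq : q ≠ 0) (hu : u ≠ 0) (hv : v ≠ 0) {a b k e : ℕ} (hbk : b ≤ k)
    (hne : ∀ f, b ≤ f → q ^ e * u ≠ q ^ f * v) (hmul : ∀ j, q ^ j * (u * v) ≠ 1) :
    rowProd q u v a b k e true =
      q ^ a * (1 - q ^ e * (u * v)) / (1 - q ^ (e + a) * (u * v)) *
        ((q ^ e * u - q ^ k * v) / (q ^ e * u - q ^ b * v)) := by
  rw [rowProd, prod_pairKernel_true_true hq hu hv hmul, prod_pairKernel_true_false hq hu hbk hne]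

theorem rowProd_false_ne_zero {q u v : K} (hq : q ≠ 0) (hv : v ≠ 0) {a b k e : ℕ} (hbk : b ≤ k)
    (hne : ∀ f ≤ a, q ^ f * v ≠ q ^ (e + 1) * u) (hmul : ∀ j, q ^ j * (u * v) ≠ 1) :
    rowProd q u v a b k e false ≠ 0 := by
  have hzero : v - q ^ (e + 1) * u ≠ 0 := by simpa using sub_ne_zero.2 (hne 0 (Nat.zero_le a))
  rw [rowProd_false hq hv hbk hne hmul]
  exact mul_ne_zero
    (div_ne_zero (mul_ne_zero (pow_ne_zero _ hq) hzero) (sub_ne_zero.2 (hne a le_rfl)))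
    (div_ne_zero (sub_ne_zero.2 (hmul _).symm) (sub_ne_zero.2 (hmul _).symm))

theorem shiftCoeff_succ_mul_rowProd_false {q u v : K} (hq : q ≠ 0) (hu : u ≠ 0) (hv : v ≠ 0)
    {a b k m : ℕ} (hbk : b ≤ k) (hfalse : ∀ f ≤ a, q ^ f * v ≠ q ^ (m + 1) * u)
    (htrue : ∀ f, b ≤ f → q ^ m * u ≠ q ^ f * v) (hmul : ∀ j, q ^ j * (u * v) ≠ 1) :
    shiftCoeff q u v k (m + 1) *
        (q ^ k * (q ^ (m + 1) * u - q ^ a * v) * (1 - q ^ (1 + m + b) * (u * v))) *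
        rowProd q u v a b k m false =
      shiftCoeff q u v k m * ((q ^ m * u - q ^ b * v) * (1 - q ^ (m + a) * (u * v))) *
        rowProd q u v a b k m true := by
  have hzero : v ≠ q ^ (m + 1) * u := by simpa using hfalse 0 (Nat.zero_le a)
  have hshift := shiftCoeff_succ hq hv hzero (hmul (1 + m + k))
  have hfa := sub_ne_zero.2 (hfalse a le_rfl)
  have hfb := sub_ne_zero.2 (hmul (1 + m + b)).symm
  have hta := sub_ne_zero.2 (hmul (m + a)).symm
  have htb := sub_ne_zero.2 (htrue b le_rfl)
  rw [rowProd_false hq hv hbk hfalse hmul, rowProd_true hq hu hv hbk htrue hmul,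
    ← neg_sub (q ^ a * v), ← neg_sub (q ^ k * v)]
  generalize q ^ a * v - q ^ (m + 1) * u = A at *
  generalize 1 - q ^ (1 + m + b) * (u * v) = B at *
  generalize 1 - q ^ (m + a) * (u * v) = C at *
  generalize q ^ m * u - q ^ b * v = D at *
  field_simp
  linear_combination -hshift

end row

section blockPairs

variable {K : Type*} [Field K]

theorem prod_range_decide_eq_rowProd (q u v : K) {k m : ℕ} (hm : m ≤ k) (e : ℕ) (ε : Bool) :
    ∏ f ∈ Finset.range k, pairKernel q (dualArg q (q ^ e * u) (q ^ f * v) ε (decide (f < m))) =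
      rowProd q u v m m k e ε := by
  rw [← Finset.prod_range_mul_prod_Ico _ hm]
  refine congrArg₂ _ (Finset.prod_congr rfl fun f hf => ?_) (Finset.prod_congr rfl fun f hf => ?_)
  · rw [decide_eq_true (Finset.mem_range.1 hf)]
  · rw [decide_eq_false (Finset.mem_Ico.1 hf).1.not_gt]

theorem decide_lt_succ_eq_decide_lt {e m : ℕ} (h : e ≠ m) :
    decide (e < m + 1) = decide (e < m) := by
  rw [decide_eq_decide]
  omega

/-- The product of the two-point weights between two blocks of sizes `k` and `k'`, whose first `m`
and `m'` elements are negative. -/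
def crossPairs (q u v : K) (k k' m m' : ℕ) : K :=
  ∏ e ∈ Finset.range k, ∏ f ∈ Finset.range k',
    pairKernel q (dualArg q (q ^ e * u) (q ^ f * v) (decide (e < m)) (decide (f < m')))

/-- The value of `crossPairs`. -/
def crossCoeff (q u v : K) (k k' m m' : ℕ) : K :=
  (q ^ m * u - q ^ m' * v) / (u - v) * ((1 - q ^ (m + m') * u * v) / (1 - u * v)) *
    (shiftCoeff q u v k' m * shiftCoeff q v u k m') *
    (qPoch (q ^ (k' + 1) * (u * v)) q k / qPoch (q * (u * v)) q k) * q ^ (k' * m + k * m')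

theorem crossPairs_symm (q u v : K) (k k' m m' : ℕ) :
    crossPairs q u v k k' m m' = crossPairs q v u k' k m' m := by
  unfold crossPairs
  rw [Finset.prod_comm]
  simp only [dualArg_comm q (_ * u)]

theorem crossCoeff_symm {q u v : K} (hmul : ∀ j, q ^ j * (u * v) ≠ 1) (k k' m m' : ℕ) :
    crossCoeff q u v k k' m m' = crossCoeff q v u k' k m' m := by
  rw [crossCoeff, crossCoeff, qPoch_div_qPoch_comm hmul, mul_comm v u, ← neg_sub v u,
    ← neg_sub (q ^ m' * v), neg_div_neg_eq, add_comm m' m, add_comm (k' * m),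
    mul_right_comm _ v u, mul_comm (shiftCoeff q u v k' m)]

theorem crossPairs_succ (q u v : K) {k k' m m' : ℕ} (hm : m < k) (hm' : m' ≤ k') :
    crossPairs q u v k k' (m + 1) m' * rowProd q u v m' m' k' m false =
      crossPairs q u v k k' m m' * rowProd q u v m' m' k' m true := by
  have hmem := Finset.mem_range.2 hm
  simp only [crossPairs, prod_range_decide_eq_rowProd q u v hm']
  rw [← Finset.mul_prod_erase _ _ hmem, ← Finset.mul_prod_erase _ _ hmem,
    Finset.prod_congr rfl fun e he => by
      rw [decide_lt_succ_eq_decide_lt (Finset.ne_of_mem_erase he)]]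
  simp only [lt_irrefl, decide_false, Nat.lt_succ_self, decide_true]
  ring

theorem crossPairs_zero_zero {q u v : K} (huv : u ≠ v) (hmul : ∀ j, q ^ j * (u * v) ≠ 1)
    (k k' : ℕ) :
    crossPairs q u v k k' 0 0 = crossCoeff q u v k k' 0 0 := by
  have hmul₀ : 1 - u * v ≠ 0 := sub_ne_zero.2 (by simpa using (hmul 0).symm)
  have hrow (e : ℕ) := prod_pairKernel_false_false (e := e) (Nat.zero_le k') hmul
  rw [← Finset.range_eq_Ico] at hrow
  simp only [crossPairs, Nat.not_lt_zero, decide_false, hrow]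
  simp only [crossCoeff, shiftCoeff_zero, pow_zero, one_mul, mul_one, mul_zero, add_zero,
    div_self (sub_ne_zero.2 huv), div_self hmul₀]
  rw [Finset.prod_div_distrib, qPoch, qPoch]
  congr 1 <;> exact Finset.prod_congr rfl fun i _ => by ring

section distinct

variable {q u v : K} (hq : q ≠ 0) (hu : u ≠ 0) (hv : v ≠ 0)
  (hne : ∀ e f, q ^ e * u ≠ q ^ f * v) (hmul : ∀ j, q ^ j * (u * v) ≠ 1)
include hq hu hv hne hmul

theorem crossCoeff_succ {k k' m m' : ℕ} (hm' : m' ≤ k') :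
    crossCoeff q u v k k' (m + 1) m' * rowProd q u v m' m' k' m false =
      crossCoeff q u v k k' m m' * rowProd q u v m' m' k' m true := by
  have key := shiftCoeff_succ_mul_rowProd_false hq hu hv (a := m') (m := m) hm'
    (fun f _ => (hne (m + 1) f).symm) (fun f _ => hne m f) hmul
  have hpow : q ^ (k' * (m + 1) + k * m') = q ^ (k' * m + k * m') * q ^ k' := by ring
  simp only [crossCoeff, hpow, mul_assoc _ u v, add_right_comm m 1 m', add_comm m m',
    add_comm 1 m] at key ⊢
  simp only [div_eq_mul_inv]
  linear_combination (u - v)⁻¹ * (1 - u * v)⁻¹ * shiftCoeff q v u k m' *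
    (qPoch (q ^ (k' + 1) * (u * v)) q k * (qPoch (q * (u * v)) q k)⁻¹) *
    q ^ (k' * m + k * m') * key

theorem crossPairs_eq_of_zero {k k' m' : ℕ} (hm' : m' ≤ k')
    (h₀ : crossPairs q u v k k' 0 m' = crossCoeff q u v k k' 0 m') {m : ℕ} (hm : m ≤ k) :
    crossPairs q u v k k' m m' = crossCoeff q u v k k' m m' := by
  induction m with
  | zero => exact h₀
  | succ m ih =>
    refine mul_right_cancel₀
      (rowProd_false_ne_zero hq hv (a := m') hm' (fun f _ => (hne (m + 1) f).symm) hmul) ?_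
    rw [crossPairs_succ q u v (by omega) hm', crossCoeff_succ hq hu hv hne hmul hm', ih (by omega)]

theorem crossPairs_eq {k k' m m' : ℕ} (hm : m ≤ k) (hm' : m' ≤ k') :
    crossPairs q u v k k' m m' = crossCoeff q u v k k' m m' := by
  have hmul' (j : ℕ) : q ^ j * (v * u) ≠ 1 := mul_comm u v ▸ hmul j
  refine crossPairs_eq_of_zero hq hu hv hne hmul hm' ?_ hm
  rw [crossPairs_symm, crossCoeff_symm hmul]
  refine crossPairs_eq_of_zero hq hv hu (fun e f => (hne f e).symm) hmul' (Nat.zero_le k) ?_ hm'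
  rw [← crossPairs_symm, ← crossCoeff_symm hmul, crossPairs_zero_zero (by simpa using hne 0 0) hmul]

end distinct

/-- The product of the two-point weights inside a block of size `k`, whose first `m` elements are
negative. -/
def innerPairs (q u : K) (k m : ℕ) : K :=
  ∏ e ∈ Finset.range k, ∏ f ∈ Finset.range k with e < f,
    pairKernel q (dualArg q (q ^ e * u) (q ^ f * u) (decide (e < m)) (decide (f < m)))

/-- The value of `innerPairs`. -/
def innerCoeff (q u : K) (k m : ℕ) : K :=
  (1 - q ^ (m + m) * u * u) / (1 - u * u) * shiftCoeff q u u k m *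
    (qPoch (q * u ^ 2) (q ^ 2) k / qPoch (q * u ^ 2) q k) * ((-1) ^ m * q ^ (k * m))

theorem prod_range_erase (f : ℕ → K) {k m : ℕ} (hm : m < k) :
    ∏ j ∈ (Finset.range k).erase m, f j =
      (∏ j ∈ Finset.range m, f j) * ∏ j ∈ Finset.Ico (m + 1) k, f j := by
  have hdisj : Disjoint (Finset.range m) (Finset.Ico (m + 1) k) :=
    Finset.disjoint_left.2 fun j h₁ h₂ => by
      simp only [Finset.mem_range, Finset.mem_Ico] at h₁ h₂
      omega
  rw [← Finset.prod_union hdisj]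
  congr 1
  ext j
  simp only [Finset.mem_erase, Finset.mem_range, Finset.mem_union, Finset.mem_Ico]
  omega

theorem innerPairs_eq_rowProd_mul (q u : K) {k m M : ℕ} (hm : m < k) (hmM : m ≤ M)
    (hMm : M ≤ m + 1) :
    innerPairs q u k M = rowProd q u u m (m + 1) k m (decide (m < M)) *
      ∏ i ∈ (Finset.range k).erase m, ∏ j ∈ (Finset.range k).erase m with i < j,
        pairKernel q (dualArg q (q ^ i * u) (q ^ j * u) (decide (i < m)) (decide (j < m))) := by
  have hdecide (j : ℕ) (hj : j ≠ m) : decide (j < M) = decide (j < m) := by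
    rw [decide_eq_decide]
    omega
  rw [innerPairs, ← Finset.insert_erase (Finset.mem_range.2 hm),
    prod_lt_insert (fun i j => by rw [dualArg_comm]) (Finset.notMem_erase _ _),
    prod_range_erase _ hm, rowProd, Finset.insert_erase (Finset.mem_range.2 hm)]
  congr 1
  · refine congrArg₂ _ (Finset.prod_congr rfl fun j hj => ?_) (Finset.prod_congr rfl fun j hj => ?_)
    · rw [decide_eq_true ((Finset.mem_range.1 hj).trans_le hmM)]
    · rw [decide_eq_false (hMm.trans (Finset.mem_Ico.1 hj).1).not_gt]
  · refine Finset.prod_congr rfl fun i hi => Finset.prod_congr rfl fun j hj => ?_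
    rw [hdecide i (Finset.ne_of_mem_erase hi),
      hdecide j (Finset.ne_of_mem_erase (Finset.mem_filter.1 hj).1)]

theorem innerPairs_succ (q u : K) {k m : ℕ} (hm : m < k) :
    innerPairs q u k (m + 1) * rowProd q u u m (m + 1) k m false =
      innerPairs q u k m * rowProd q u u m (m + 1) k m true := by
  rw [innerPairs_eq_rowProd_mul q u hm (Nat.le_succ m) le_rfl,
    innerPairs_eq_rowProd_mul q u hm le_rfl (Nat.le_succ m), decide_eq_true (Nat.lt_succ_self m),
    decide_eq_false (lt_irrefl m)]
  ring

theorem innerPairs_zero {q u : K} (hmul : ∀ j, q ^ j * (u * u) ≠ 1) (k : ℕ) :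
    innerPairs q u k 0 = innerCoeff q u k 0 := by
  have hmul₀ : 1 - u * u ≠ 0 := sub_ne_zero.2 (by simpa using (hmul 0).symm)
  have hrow : innerPairs q u k 0 = ∏ e ∈ Finset.range k,
      (1 - q ^ (1 + e + k) * (u * u)) / (1 - q ^ (2 + e + e) * (u * u)) := by
    refine Finset.prod_congr rfl fun e he => ?_
    have hf : (Finset.range k).filter (e < ·) = Finset.Ico (e + 1) k := by
      ext j
      simp only [Finset.mem_filter, Finset.mem_range, Finset.mem_Ico]
      omega
    simp only [Nat.not_lt_zero, decide_false]
    rw [hf, prod_pairKernel_false_false (Nat.succ_le_of_lt (Finset.mem_range.1 he)) hmul,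
      show 1 + e + (e + 1) = 2 + e + e by ring]
  have hden : qPoch (q * (u * u)) q k ≠ 0 :=
    qPoch_ne_zero fun i _ h => hmul (i + 1) (by rw [← h]; ring)
  have hshift : ∏ e ∈ Finset.range k, (1 - q ^ (1 + e + k) * (u * u)) =
      qPoch (q * (u * u) * q ^ k) q k := Finset.prod_congr rfl fun i _ => by ring
  have hsplit := qPoch_add_self q (u * u) k
  rw [qPoch_add, ← hshift] at hsplit
  rw [hrow, innerCoeff, Finset.prod_div_distrib]
  simp only [shiftCoeff_zero, pow_zero, one_mul, mul_one, mul_zero, add_zero, div_self hmul₀, sq u]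
  rw [div_eq_div_iff (Finset.prod_ne_zero_iff.2 fun e _ => sub_ne_zero.2 (hmul _).symm) hden,
    mul_comm, hsplit]

section single

variable {q u : K} (hq : q ≠ 0) (hu : u ≠ 0) (hne : ∀ e f, e ≠ f → q ^ e * u ≠ q ^ f * u)
  (hmul : ∀ j, q ^ j * (u * u) ≠ 1)
include hq hu hne hmul

theorem innerCoeff_succ {k m : ℕ} (hm : m < k) :
    innerCoeff q u k (m + 1) * rowProd q u u m (m + 1) k m false =
      innerCoeff q u k m * rowProd q u u m (m + 1) k m true := by
  have key := shiftCoeff_succ_mul_rowProd_false hq hu hu (a := m) (b := m + 1) hm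
    (fun f hf => hne f (m + 1) (by omega)) (fun f hf => hne m f (by omega)) hmul
  have hdiff : q ^ m * u - q ^ (m + 1) * u ≠ 0 := sub_ne_zero.2 (hne _ _ (by omega))
  have hsucc : innerCoeff q u k (m + 1) = (1 - u * u)⁻¹ * (shiftCoeff q u u k (m + 1) *
      (q ^ k * (1 - q ^ (1 + m + (m + 1)) * (u * u)))) *
      (qPoch (q * u ^ 2) (q ^ 2) k / qPoch (q * u ^ 2) q k) * (-((-1) ^ m * q ^ (k * m))) := by
    rw [innerCoeff]
    ring
  rw [hsucc, innerCoeff]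
  refine mul_right_cancel₀ hdiff ?_
  linear_combination (1 - u * u)⁻¹ *
    (qPoch (q * u ^ 2) (q ^ 2) k / qPoch (q * u ^ 2) q k) * ((-1) ^ m * q ^ (k * m)) * key

theorem innerPairs_eq {k m : ℕ} (hm : m ≤ k) : innerPairs q u k m = innerCoeff q u k m := by
  induction m with
  | zero => exact innerPairs_zero hmul k
  | succ m ih =>
    refine mul_right_cancel₀ (rowProd_false_ne_zero hq hu (a := m) hm
      (fun f hf => hne f (m + 1) (by omega)) hmul) ?_
    rw [innerPairs_succ q u hm, innerCoeff_succ hq hu hne hmul hm, ih (by omega)]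

end single

end blockPairs

section blockSet

variable {κ : Type*} [Fintype κ]

/-- The disjoint union of blocks of sizes `k l`, ordered lexicographically. -/
def blockSet (k : κ → ℕ) : Finset (κ ×ₗ ℕ) :=
  (Finset.univ.sigma fun l => Finset.range (k l)).map
    ((Equiv.sigmaEquivProd κ ℕ).trans toLex).toEmbedding

theorem mem_blockSet {k : κ → ℕ} {p : κ ×ₗ ℕ} :
    p ∈ blockSet k ↔ (ofLex p).2 < k (ofLex p).1 := by
  rw [blockSet, Finset.mem_map_equiv]
  simp

theorem prod_blockSet {M : Type*} [CommMonoid M] (k : κ → ℕ) (f : κ ×ₗ ℕ → M) :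
    ∏ p ∈ blockSet k, f p = ∏ l, ∏ e ∈ Finset.range (k l), f (toLex (l, e)) := by
  rw [blockSet, Finset.prod_map, Finset.prod_sigma]
  rfl

theorem card_blockSet (k : κ → ℕ) : (blockSet k).card = ∑ l, k l := by
  simp [blockSet]

theorem blockSet_injective : Function.Injective (blockSet (κ := κ)) := fun m m' h => by
  have hlt (l : κ) (e : ℕ) : e < m l ↔ e < m' l := by
    simpa [mem_blockSet] using Finset.ext_iff.1 h (toLex (l, e))
  exact funext fun l => eq_of_forall_lt_iff fun e => hlt l e

theorem exists_blockSet_eq {k : κ → ℕ} {S : Finset (κ ×ₗ ℕ)} (hS : S ⊆ blockSet k)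
    (hpred : ∀ l e, toLex (l, e + 1) ∈ S → toLex (l, e) ∈ S) : ∃ m ≤ k, blockSet m = S := by
  classical
  have hdown (l : κ) (e f : ℕ) (hef : e ≤ f) : toLex (l, f) ∈ S → toLex (l, e) ∈ S := by
    induction f, hef using Nat.le_induction with
    | base => exact id
    | succ f _ ih => exact fun h => ih (hpred l f h)
  have hend (l : κ) : toLex (l, k l) ∉ S := fun h => (mem_blockSet.1 (hS h)).false
  have hex (l : κ) : ∃ e, toLex (l, e) ∉ S := ⟨k l, hend l⟩
  refine ⟨fun l => Nat.find (hex l), fun l => Nat.find_min' (hex l) (hend l), ?_⟩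
  ext p
  obtain ⟨⟨l, e⟩, rfl⟩ := toLex.surjective p
  rw [mem_blockSet, ofLex_toLex, Nat.lt_find_iff]
  exact ⟨fun h => not_not.1 (h e le_rfl), fun h f hf => not_not.2 (hdown l f e hf h)⟩

variable [LinearOrder κ]

theorem prod_lt_blockSet_row {M : Type*} [CommMonoid M] [LocallyFiniteOrderTop κ] (k : κ → ℕ)
    (a : κ) (e : ℕ) (f : κ ×ₗ ℕ → M) :
    ∏ p ∈ blockSet k with toLex (a, e) < p, f p =
      (∏ b ∈ Finset.Ioi a, ∏ e' ∈ Finset.range (k b), f (toLex (b, e'))) *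
        ∏ e' ∈ Finset.range (k a) with e < e', f (toLex (a, e')) := by
  have hsplit (b : κ) :
      ∏ e' ∈ Finset.range (k b), (if toLex (a, e) < toLex (b, e') then f (toLex (b, e')) else 1) =
        (if a < b then ∏ e' ∈ Finset.range (k b), f (toLex (b, e')) else 1) *
          if b = a then ∏ e' ∈ Finset.range (k b) with e < e', f (toLex (b, e')) else 1 := by
    rcases lt_trichotomy a b with h | rfl | h
    · simp [Prod.Lex.toLex_lt_toLex, h, h.ne']
    · simp [Prod.Lex.toLex_lt_toLex, Finset.prod_filter]
    · simp [Prod.Lex.toLex_lt_toLex, h.not_gt, h.ne, h.ne']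
  rw [Finset.prod_filter, prod_blockSet, ← Finset.filter_lt_eq_Ioi, Finset.prod_filter,
    Finset.prod_congr rfl fun b _ => hsplit b, Finset.prod_mul_distrib,
    Finset.prod_ite_eq_of_mem' _ _ _ (Finset.mem_univ a)]

theorem prod_lt_blockSet {M : Type*} [CommMonoid M] [LocallyFiniteOrderTop κ] (k : κ → ℕ)
    (f : κ ×ₗ ℕ → κ ×ₗ ℕ → M) :
    ∏ p ∈ blockSet k, ∏ p' ∈ blockSet k with p < p', f p p' =
      (∏ a, ∏ b ∈ Finset.Ioi a, ∏ e ∈ Finset.range (k a), ∏ e' ∈ Finset.range (k b),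
        f (toLex (a, e)) (toLex (b, e'))) *
      ∏ a, ∏ e ∈ Finset.range (k a), ∏ e' ∈ Finset.range (k a) with e < e',
        f (toLex (a, e)) (toLex (a, e')) := by
  rw [prod_blockSet, ← Finset.prod_mul_distrib]
  refine Finset.prod_congr rfl fun a _ => ?_
  rw [Finset.prod_comm, ← Finset.prod_mul_distrib]
  exact Finset.prod_congr rfl fun e _ => prod_lt_blockSet_row k a e _

end blockSet

section signSumBlockSet

variable {R ι : Type*} [CommSemiring R] [LinearOrder ι]

theorem signTerm_eq_zero {I : Finset ι} (A : ι → Bool → R) {G : ι → Bool → ι → Bool → R}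
    {τ : ι → Bool} {i j : ι} (hi : i ∈ I) (hj : j ∈ I) (hij : i < j)
    (h : G i (τ i) j (τ j) = 0) : signTerm I A G τ = 0 :=
  mul_eq_zero_of_right _ <|
    Finset.prod_eq_zero hi (Finset.prod_eq_zero (Finset.mem_filter.2 ⟨hj, hij⟩) h)

-- The hypothesis kills every choice of signs in which, inside some block, `-1` follows `+1`.
theorem signSum_blockSet {κ : Type*} [Fintype κ] [LinearOrder κ] (k : κ → ℕ)
    (A : κ ×ₗ ℕ → Bool → R) {G : κ ×ₗ ℕ → Bool → κ ×ₗ ℕ → Bool → R}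
    (hG : ∀ l e, G (toLex (l, e)) false (toLex (l, e + 1)) true = 0) :
    signSum (blockSet k) A G = ∑ m ∈ Finset.Iic k,
      signTerm (blockSet k) A G fun p => decide ((ofLex p).2 < m (ofLex p).1) := by
  have hdecide (m : κ → ℕ) : (fun p => decide ((ofLex p).2 < m (ofLex p).1)) =
      fun p : κ ×ₗ ℕ => decide (p ∈ blockSet m) := by
    simp only [mem_blockSet]
  simp only [hdecide]
  rw [signSum, ← Finset.sum_image (g := blockSet)
    (f := fun S => signTerm (blockSet k) A G fun p => decide (p ∈ S)) blockSet_injective.injOn]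
  refine (Finset.sum_subset ?_ fun S hS hS' => ?_).symm
  · intro S hS
    obtain ⟨m, hm, rfl⟩ := Finset.mem_image.1 hS
    exact Finset.mem_powerset.2 fun p hp =>
      mem_blockSet.2 ((mem_blockSet.1 hp).trans_le (Finset.mem_Iic.1 hm _))
  · rw [Finset.mem_powerset] at hS
    have hgap : ∃ l e, toLex (l, e + 1) ∈ S ∧ toLex (l, e) ∉ S := by
      by_contra! hpred
      obtain ⟨m, hm, rfl⟩ := exists_blockSet_eq hS hpred
      exact hS' (Finset.mem_image_of_mem _ (Finset.mem_Iic.2 hm))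
    obtain ⟨l, e, hmem, hnotMem⟩ := hgap
    have hmem' : toLex (l, e) ∈ blockSet k :=
      mem_blockSet.2 ((Nat.lt_succ_self e).trans (mem_blockSet.1 (hS hmem)))
    refine signTerm_eq_zero A hmem' (hS hmem) (by simp [Prod.Lex.toLex_lt_toLex]) ?_
    rw [decide_eq_false hnotMem, decide_eq_true hmem, hG]

theorem signSum_univ [Fintype ι] [LocallyFiniteOrderTop ι] (A : ι → Bool → R)
    (G : ι → Bool → ι → Bool → R) :
    signSum Finset.univ A G = ∑ σ : ι → ℤˣ, (∏ i, A i (decide (σ i = -1))) *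
      ∏ i, ∏ j ∈ Finset.Ioi i, G i (decide (σ i = -1)) j (decide (σ j = -1)) := by
  unfold signSum signTerm
  refine Finset.sum_nbij' (fun S i => if i ∈ S then -1 else 1)
    (fun σ => Finset.univ.filter fun i => σ i = -1) (by simp) (by simp) ?_ ?_ ?_
  · intro S _
    ext i
    by_cases h : i ∈ S <;> simp [h]
  · intro σ _
    funext i
    rcases Int.units_eq_one_or (σ i) with h | h <;> simp [h]
  · intro S _
    have hdecide (i : ι) : decide ((if i ∈ S then (-1 : ℤˣ) else 1) = -1) = decide (i ∈ S) := by
      by_cases h : i ∈ S <;> simp [h]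
    simp only [hdecide, Finset.filter_lt_eq_Ioi]

end signSumBlockSet

theorem prod_prod_Ici {M ι : Type*} [CommMonoid M] [Fintype ι] [PartialOrder ι]
    [LocallyFiniteOrderTop ι] (f : ι → ι → M) :
    ∏ a, ∏ b ∈ Finset.Ici a, f a b = (∏ a, f a a) * ∏ a, ∏ b ∈ Finset.Ioi a, f a b := by
  simp only [← Finset.mul_prod_Ioi_eq_prod_Ici, Finset.prod_mul_distrib]

theorem prod_prod_eq_diag_mul {M ι : Type*} [CommMonoid M] [Fintype ι] [LinearOrder ι]
    [LocallyFiniteOrderTop ι] [LocallyFiniteOrderBot ι] (f : ι → ι → M) :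
    ∏ a, ∏ b, f a b = (∏ a, f a a) * ∏ a, ∏ b ∈ Finset.Ioi a, (f a b * f b a) := by
  rw [Finset.prod_congr rfl fun a _ => Finset.prod_congr rfl fun b _ => mul_comm (f a b) (f b a),
    Finset.prod_prod_Ioi_mul_eq_prod_prod_off_diag (fun b a => f b a), Finset.prod_comm,
    ← Finset.prod_mul_distrib]
  refine Finset.prod_congr rfl fun a _ => ?_
  rw [← Finset.prod_compl_mul_prod {a}, Finset.prod_singleton, mul_comm]

section blockVar

variable {K ι κ : Type*} [Field K] {q : K} {x : ι → K} {z : κ → K}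

/-- The geometric progressions with ratio `q` and initial terms `z l`. -/
def blockVar (q : K) (z : κ → K) (p : κ ×ₗ ℕ) : K := q ^ (ofLex p).2 * z (ofLex p).1

namespace Generic

variable (g : Generic q x (blockVar q z))
include g

theorem z_ne_of_blockVar (l : κ) : z l ≠ 0 :=
  right_ne_zero_of_mul (g.z_ne (toLex (l, 0)))

theorem pow_mul_ne_pow_mul {a b : κ} {e f : ℕ} (h : (a, e) ≠ (b, f)) :
    q ^ e * z a ≠ q ^ f * z b :=
  g.zz_ne (toLex (a, e)) (toLex (b, f)) (toLex.injective.ne h)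

theorem pow_mul_mul_ne_one (hzz : ∀ a b, z a * z b ≠ 1) (a b : κ) (j : ℕ) :
    q ^ j * (z a * z b) ≠ 1 := by
  cases j with
  | zero => simpa using hzz a b
  | succ j =>
    have := g.qzz_mul (toLex (a, j)) (toLex (b, 0))
    simp only [blockVar, ofLex_toLex, pow_zero, one_mul] at this
    rwa [pow_succ', mul_assoc, ← mul_assoc (q ^ j)]

theorem one_sub_pow_mul_signPow_ne_zero (l : κ) (e : ℕ) (i : ι) (ε : Bool) :
    1 - q ^ e * z l * signPow (x i) ε ≠ 0 :=
  g.one_sub_mul_signPow_ne_zero (toLex (l, e)) i ε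

theorem kernZ_blockVar_eq_zero (l : κ) (e : ℕ) :
    kernZ q (blockVar q z) (toLex (l, e)) false (toLex (l, e + 1)) true = 0 := by
  have hone : q * (blockVar q z (toLex (l, e)) / blockVar q z (toLex (l, e + 1))) = 1 := by
    rw [mul_div_assoc', div_eq_one_iff_eq (g.z_ne _)]
    simp only [blockVar, ofLex_toLex]
    ring
  simp only [kernZ, pairKernel, dualArg, hone, sub_self, zero_div]

theorem weightX_blockVar [Fintype κ] (k : κ → ℕ) (i : ι) (ε : Bool) :
    weightX q x (blockVar q z) (blockSet k) i ε =
      (1 - q * signPow (x i) ε ^ 2) / (1 - signPow (x i) ε ^ 2) *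
        ∏ l, (1 - q ^ k l * z l * signPow (x i) (!ε)) / (1 - z l * signPow (x i) (!ε)) := by
  rw [weightX, prod_blockSet]
  refine congrArg _ (Finset.prod_congr rfl fun l _ => ?_)
  rw [Finset.range_eq_Ico, prod_Ico_eq_div (F := fun e => 1 - q ^ e * z l * signPow (x i) (!ε))
    (Nat.zero_le _) (fun e _ _ => g.one_sub_pow_mul_signPow_ne_zero l e i _)
    (fun e _ _ => by simp only [blockVar, ofLex_toLex, pow_succ', mul_assoc]), pow_zero, one_mul]

end Generic

theorem crossFactor_pow_mul (q x z : K) (e : ℕ) :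
    crossFactor q x (q ^ e * z) = q⁻¹ *
      ((1 - q * (x * z) * q ^ e) / (1 - x * z * q ^ e) *
        ((1 - q * (z / x) * q ^ e) / (1 - z / x * q ^ e))) := by
  rw [crossFactor, div_mul_div_comm, ← one_div, div_mul_div_comm, one_mul]
  congr 1 <;> ring

theorem prod_crossFactor_pow_mul (q x z : K) (m : ℕ) :
    ∏ e ∈ Finset.range m, crossFactor q x (q ^ e * z) = q⁻¹ ^ m *
      (qPoch (q * (x * z)) q m / qPoch (x * z) q m *
        (qPoch (q * (z / x)) q m / qPoch (z / x) q m)) := by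
  simp only [crossFactor_pow_mul, Finset.prod_mul_distrib, Finset.prod_div_distrib,
    Finset.prod_const, Finset.card_range, qPoch]

theorem prod_range_weightZ_blockVar (q : K) (x : ι → K) (z : κ → K) (I : Finset ι) (l : κ)
    {k m : ℕ} (hm : m ≤ k) :
    ∏ e ∈ Finset.range k, weightZ q x (blockVar q z) I (toLex (l, e)) (decide (e < m)) =
      ∏ i ∈ I, ∏ e ∈ Finset.range m, crossFactor q (x i) (q ^ e * z l) := by
  rw [← Finset.prod_range_mul_prod_Ico _ hm, Finset.prod_comm]
  have hneg (e : ℕ) (he : e ∈ Finset.range m) :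
      weightZ q x (blockVar q z) I (toLex (l, e)) (decide (e < m)) =
        ∏ i ∈ I, crossFactor q (x i) (q ^ e * z l) := by
    rw [decide_eq_true (Finset.mem_range.1 he)]
    rfl
  have hpos (e : ℕ) (he : e ∈ Finset.Ico m k) :
      weightZ q x (blockVar q z) I (toLex (l, e)) (decide (e < m)) = 1 := by
    rw [decide_eq_false (Finset.mem_Ico.1 he).1.not_gt]
    rfl
  rw [Finset.prod_congr rfl hneg, Finset.prod_eq_one hpos, mul_one]

theorem prod_weightZ_blockSet [Fintype κ] {q : K} (x : ι → K) (z : κ → K) (I : Finset ι)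
    {k m : κ → ℕ} (hm : m ≤ k) :
    ∏ p ∈ blockSet k, weightZ q x (blockVar q z) I p (decide ((ofLex p).2 < m (ofLex p).1)) =
      q⁻¹ ^ (I.card * ∑ l, m l) * ∏ i ∈ I, ∏ l,
        (qPoch (q * (x i * z l)) q (m l) / qPoch (x i * z l) q (m l)) *
          (qPoch (q * (z l / x i)) q (m l) / qPoch (z l / x i) q (m l)) := by
  rw [prod_blockSet]
  refine (Finset.prod_congr rfl fun l _ =>
    prod_range_weightZ_blockVar q x z I l (hm l)).trans ?_
  rw [Finset.prod_comm]
  simp only [prod_crossFactor_pow_mul, Finset.prod_mul_distrib, Finset.prod_pow_eq_pow_sum,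
    Finset.sum_const, smul_eq_mul]

end blockVar

section reduction

variable {K : Type*} [Field K] {n s : ℕ}

/-- The left-hand side of the reduction formula. -/
def signSide (q : K) (x : Fin n → K) (z : Fin s → K) (k : Fin s → ℕ) : K :=
  ∑ σ : Fin n → ℤˣ,
    (∏ i,
      ((1 - q * x i ^ (2 * (σ i : ℤ))) / (1 - x i ^ (2 * (σ i : ℤ))) *
        ∏ l, (1 - q ^ k l * z l * x i ^ (-(σ i : ℤ))) / (1 - z l * x i ^ (-(σ i : ℤ))))) *
    ∏ i, ∏ j ∈ Finset.Ioi i,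
      (1 - q * (x i ^ (σ i : ℤ) * x j ^ (σ j : ℤ))) /
        (1 - x i ^ (σ i : ℤ) * x j ^ (σ j : ℤ))

/-- The right-hand side of the reduction formula, a sum over the box `0 ≤ m ≤ k`. -/
def boxSide (q : K) (x : Fin n → K) (z : Fin s → K) (k : Fin s → ℕ) : K :=
  q ^ ((n : ℤ) * ((∑ l, k l : ℕ) : ℤ) - ((∑ l, k l).choose 2 : ℤ)) *
    qPochInt (-q) q ((n : ℤ) - ((∑ l, k l : ℕ) : ℤ)) *
    (∏ a, ∏ b ∈ Finset.Ioi a,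
      qPoch (q ^ (k b + 1) * (z a * z b)) q (k a) / qPoch (q * (z a * z b)) q (k a)) *
    (∏ a, qPoch (q * z a ^ 2) (q ^ 2) (k a) / qPoch (q * z a ^ 2) q (k a)) *
    ∑ m ∈ Finset.Iic k,
      (-1) ^ (∑ l, m l) * coeffC q k z m *
        q ^ ((((∑ l, k l : ℕ) : ℤ) - (n : ℤ)) * ((∑ l, m l : ℕ) : ℤ)) *
        ∏ i, ∏ l,
          (qPoch (q * (x i * z l)) q (m l) / qPoch (x i * z l) q (m l)) *
          (qPoch (q * (z l / x i)) q (m l) / qPoch (z l / x i) q (m l))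

theorem signPow_decide (x : K) (u : ℤˣ) : signPow x (decide (u = -1)) = x ^ (u : ℤ) := by
  rcases Int.units_eq_one_or u with rfl | rfl <;> simp [signPow]

variable {q : K} {x : Fin n → K} {z : Fin s → K}

theorem signSide_eq_sumX (g : Generic q x (blockVar q z)) (k : Fin s → ℕ) :
    signSide q x z k = sumX q x (blockVar q z) Finset.univ (blockSet k) := by
  rw [sumX, signSum_univ, signSide]
  simp only [g.weightX_blockVar, kernX, pairKernel, signPow_not, signPow_decide, zpow_neg,
    mul_comm (2 : ℤ), zpow_mul, zpow_ofNat]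

theorem pow_sum_mul_sum (q : K) (k m : Fin s → ℕ) :
    q ^ ((∑ l, k l) * ∑ l, m l) = (∏ a, q ^ (k a * m a)) *
      ∏ a, ∏ b ∈ Finset.Ioi a, q ^ (k b * m a + k a * m b) := by
  simp only [pow_add]
  rw [← prod_prod_eq_diag_mul fun a b => q ^ (k b * m a), Finset.sum_mul_sum, Finset.sum_comm]
  simp only [Finset.prod_pow_eq_pow_sum]

theorem coeffC_eq (q : K) (k : Fin s → ℕ) (z : Fin s → K) (m : Fin s → ℕ) :
    coeffC q k z m =
      (∏ a, (1 - q ^ (m a + m a) * z a * z a) / (1 - z a * z a) *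
        shiftCoeff q (z a) (z a) (k a) (m a)) *
      ∏ a, ∏ b ∈ Finset.Ioi a, ((q ^ m a * z a - q ^ m b * z b) / (z a - z b) *
        ((1 - q ^ (m a + m b) * z a * z b) / (1 - z a * z b)) *
        (shiftCoeff q (z a) (z b) (k b) (m a) * shiftCoeff q (z b) (z a) (k a) (m b))) := by
  have hshift := prod_prod_eq_diag_mul fun a b => shiftCoeff q (z a) (z b) (k b) (m a)
  simp only [shiftCoeff] at hshift
  rw [coeffC, prod_prod_Ici, hshift]
  simp only [shiftCoeff, Finset.prod_mul_distrib]
  ring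

theorem prod_kernZ_blockSet (g : Generic q x (blockVar q z)) (hzz : ∀ a b, z a * z b ≠ 1)
    {k m : Fin s → ℕ} (hm : m ≤ k) :
    ∏ p ∈ blockSet k, ∏ p' ∈ blockSet k with p < p', kernZ q (blockVar q z)
      p (decide ((ofLex p).2 < m (ofLex p).1)) p' (decide ((ofLex p').2 < m (ofLex p').1)) =
    (∏ a, ∏ b ∈ Finset.Ioi a,
      qPoch (q ^ (k b + 1) * (z a * z b)) q (k a) / qPoch (q * (z a * z b)) q (k a)) *
    (∏ a, qPoch (q * z a ^ 2) (q ^ 2) (k a) / qPoch (q * z a ^ 2) q (k a)) *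
    ((-1) ^ (∑ l, m l) * coeffC q k z m * q ^ ((∑ l, k l) * (∑ l, m l))) := by
  have hz := g.z_ne_of_blockVar
  have hmul := g.pow_mul_mul_ne_one hzz
  have hcross (a b : Fin s) (hb : b ∈ Finset.Ioi a) :
      crossPairs q (z a) (z b) (k a) (k b) (m a) (m b) =
        crossCoeff q (z a) (z b) (k a) (k b) (m a) (m b) :=
    crossPairs_eq g.q_ne (hz a) (hz b)
      (fun e f => g.pow_mul_ne_pow_mul fun h => (Finset.mem_Ioi.1 hb).ne (congrArg Prod.fst h))
      (hmul a b) (hm a) (hm b)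
  have hinner (a : Fin s) : innerPairs q (z a) (k a) (m a) = innerCoeff q (z a) (k a) (m a) :=
    innerPairs_eq g.q_ne (hz a)
      (fun e f hef => g.pow_mul_ne_pow_mul fun h => hef (congrArg Prod.snd h)) (hmul a a) (hm a)
  calc
    _ = (∏ a, ∏ b ∈ Finset.Ioi a, crossPairs q (z a) (z b) (k a) (k b) (m a) (m b)) *
          ∏ a, innerPairs q (z a) (k a) (m a) := by
      rw [prod_lt_blockSet]
      rfl
    _ = (∏ a, ∏ b ∈ Finset.Ioi a, crossCoeff q (z a) (z b) (k a) (k b) (m a) (m b)) *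
          ∏ a, innerCoeff q (z a) (k a) (m a) := by
      rw [Finset.prod_congr rfl fun a _ => Finset.prod_congr rfl (hcross a),
        Finset.prod_congr rfl fun a _ => hinner a]
    _ = _ := by
      rw [coeffC_eq, pow_sum_mul_sum, ← Finset.prod_pow_eq_pow_sum]
      simp only [crossCoeff, innerCoeff, Finset.prod_mul_distrib]
      ring

theorem signSide_eq_boxSide_of_generic (g : Generic q x (blockVar q z))
    (hzz : ∀ a b, z a * z b ≠ 1) (k : Fin s → ℕ) : signSide q x z k = boxSide q x z k := by
  rw [signSide_eq_sumX g, sumX_eq_sumZ g, card_blockSet, Finset.card_univ, Fintype.card_fin,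
    sumZ, signSum_blockSet k _ g.kernZ_blockVar_eq_zero, boxSide, dualityConst, Finset.mul_sum,
    Finset.mul_sum]
  refine Finset.sum_congr rfl fun m hm => ?_
  rw [Finset.mem_Iic] at hm
  have hpow : q ^ ((((∑ l, k l : ℕ) : ℤ) - (n : ℤ)) * ((∑ l, m l : ℕ) : ℤ)) =
      q⁻¹ ^ (n * ∑ l, m l) * q ^ ((∑ l, k l) * (∑ l, m l)) := by
    rw [sub_mul, zpow_sub₀ g.q_ne, div_eq_inv_mul, inv_pow]
    norm_cast
  rw [signTerm, prod_weightZ_blockSet x z _ hm, prod_kernZ_blockSet g hzz hm, hpow,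
    Finset.card_univ, Fintype.card_fin]
  ring

end reduction

/-! ### Specialisation of indeterminates -/

/-- `v` is the value of the fraction `f` under the ring homomorphism `φ`, which does not kill the
denominator of `f`. In other words, `φ` extends to a localization that contains `f`, and maps `f`
to `v`. -/
def HasValue {A F K : Type*} [CommRing A] [Field F] [Algebra A F] [Field K] (φ : A →+* K)
    (f : F) (v : K) : Prop :=
  ∃ a b : A, φ b ≠ 0 ∧ f = algebraMap A F a / algebraMap A F b ∧ v = φ a / φ b

namespace HasValue

variable {A F K : Type*} [CommRing A] [Field F] [Algebra A F] [Field K] {φ : A →+* K}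
  {f g : F} {v w : K}

theorem of_map (φ : A →+* K) (a : A) : HasValue φ (algebraMap A F a) (φ a) :=
  ⟨a, 1, by simp, by simp, by simp⟩

theorem one : HasValue φ (1 : F) 1 := by simpa using of_map (F := F) φ 1

theorem zero : HasValue φ (0 : F) 0 := by simpa using of_map (F := F) φ 0

theorem mul (hf : HasValue φ f v) (hg : HasValue φ g w) : HasValue φ (f * g) (v * w) := by
  obtain ⟨a, b, hb, rfl, rfl⟩ := hf
  obtain ⟨a', b', hb', rfl, rfl⟩ := hg
  exact ⟨a * a', b * b', by simp [hb, hb'], by simp [div_mul_div_comm],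
    by simp [div_mul_div_comm]⟩

theorem neg (hf : HasValue φ f v) : HasValue φ (-f) (-v) := by
  obtain ⟨a, b, hb, rfl, rfl⟩ := hf
  exact ⟨-a, b, hb, by simp [neg_div], by simp [neg_div]⟩

theorem inv (hf : HasValue φ f v) (hv : v ≠ 0) : HasValue φ f⁻¹ v⁻¹ := by
  obtain ⟨a, b, -, rfl, rfl⟩ := hf
  exact ⟨b, a, (div_ne_zero_iff.1 hv).1, inv_div _ _, inv_div _ _⟩

theorem div (hf : HasValue φ f v) (hg : HasValue φ g w) (hw : w ≠ 0) :
    HasValue φ (f / g) (v / w) := by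
  simpa only [div_eq_mul_inv] using hf.mul (hg.inv hw)

theorem prod {ι : Type*} {s : Finset ι} {f : ι → F} {v : ι → K}
    (h : ∀ i ∈ s, HasValue φ (f i) (v i)) : HasValue φ (∏ i ∈ s, f i) (∏ i ∈ s, v i) := by
  classical
  induction s using Finset.induction_on with
  | empty => simpa using one
  | insert a s ha ih =>
    rw [Finset.prod_insert ha, Finset.prod_insert ha]
    exact (h a (by simp)).mul (ih fun i hi => h i (by simp [hi]))

theorem pow (hf : HasValue φ f v) (j : ℕ) : HasValue φ (f ^ j) (v ^ j) := by
  simpa using prod (s := Finset.range j) fun _ _ => hf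

theorem zpow (hf : HasValue φ f v) (hv : v ≠ 0) (j : ℤ) : HasValue φ (f ^ j) (v ^ j) := by
  cases j with
  | ofNat j => simpa using hf.pow j
  | negSucc j => simpa only [zpow_negSucc] using (hf.pow _).inv (pow_ne_zero _ hv)

variable [IsFractionRing A F]

theorem algebraMap_ne_zero {b : A} (hb : φ b ≠ 0) : algebraMap A F b ≠ 0 := fun h =>
  hb (by rw [(map_eq_zero_iff _ (IsFractionRing.injective A F)).1 h, map_zero])

theorem unique (hv : HasValue φ f v) (hw : HasValue φ f w) : v = w := by
  obtain ⟨a, b, hb, hf, rfl⟩ := hv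
  obtain ⟨a', b', hb', hf', rfl⟩ := hw
  rw [hf, div_eq_div_iff (algebraMap_ne_zero hb) (algebraMap_ne_zero hb'), ← map_mul,
    ← map_mul] at hf'
  rw [div_eq_div_iff hb hb', ← map_mul, ← map_mul, IsFractionRing.injective A F hf']

theorem ne (hf : HasValue φ f v) (hg : HasValue φ g w) (hvw : v ≠ w) : f ≠ g := by
  rintro rfl
  exact hvw (hf.unique hg)

theorem add (hf : HasValue φ f v) (hg : HasValue φ g w) : HasValue φ (f + g) (v + w) := by
  obtain ⟨a, b, hb, rfl, rfl⟩ := hf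
  obtain ⟨a', b', hb', rfl, rfl⟩ := hg
  refine ⟨a * b' + b * a', b * b', by simp [hb, hb'], ?_, ?_⟩
  · rw [div_add_div _ _ (algebraMap_ne_zero hb) (algebraMap_ne_zero hb')]
    simp only [map_add, map_mul]
  · rw [div_add_div _ _ hb hb']
    simp only [map_add, map_mul]

theorem sub (hf : HasValue φ f v) (hg : HasValue φ g w) : HasValue φ (f - g) (v - w) := by
  simpa only [sub_eq_add_neg] using hf.add hg.neg

theorem sum {ι : Type*} {s : Finset ι} {f : ι → F} {v : ι → K}
    (h : ∀ i ∈ s, HasValue φ (f i) (v i)) : HasValue φ (∑ i ∈ s, f i) (∑ i ∈ s, v i) := by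
  classical
  induction s using Finset.induction_on with
  | empty => simpa using zero
  | insert a s ha ih =>
    rw [Finset.sum_insert ha, Finset.sum_insert ha]
    exact (h a (by simp)).add (ih fun i hi => h i (by simp [hi]))

theorem qPoch (hf : HasValue φ f v) (hg : HasValue φ g w) (j : ℕ) :
    HasValue φ (qPoch f g j) (qPoch v w j) :=
  prod fun i _ => one.sub (hf.mul (hg.pow i))

theorem qPochInt (hf : HasValue φ f v) (hg : HasValue φ g w) (hw : w ≠ 0) {N : ℤ}
    (h : ∀ e : ℤ, N ≤ e → e < 0 → v * w ^ e ≠ 1) :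
    HasValue φ (qPochInt f g N) (qPochInt v w N) := by
  cases N with
  | ofNat N => exact qPoch hf hg N
  | negSucc M =>
    refine (qPoch (hf.mul (hg.zpow hw _)) hg (M + 1)).inv (qPoch_ne_zero fun i hi => ?_)
    rw [mul_assoc, ← zpow_natCast, ← zpow_add₀ hw]
    exact h _ (by rw [Int.negSucc_eq]; omega) (by omega)

end HasValue

/-- The parameters are nonzero, and no denominator of the reduction formula vanishes. -/
structure Admissible {K : Type*} [Field K] {n s : ℕ} (q : K) (x : Fin n → K) (z : Fin s → K)
    (k : Fin s → ℕ) : Prop where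
  k_pos : ∀ l, 0 < k l
  q_ne : q ≠ 0
  x_ne : ∀ i, x i ≠ 0
  z_ne : ∀ l, z l ≠ 0
  x_sq : ∀ i, x i ^ 2 ≠ 1
  xx : ∀ i j, i < j → x i * x j ≠ 1 ∧ x i ≠ x j
  zx : ∀ l i, ∀ e < k l, q ^ e * (z l * x i) ≠ 1 ∧ q ^ e * (z l / x i) ≠ 1
  zz_mul : ∀ a b, ∀ e ≤ k a + k b, q ^ e * (z a * z b) ≠ 1
  zz_ne : ∀ a b, a ≠ b → z a ≠ z b
  zz_div : ∀ a b, ∀ e : ℕ, 1 ≤ e → e ≤ k a → q ^ e * (z a / z b) ≠ 1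
  q_pow : ∀ e : ℕ, n + e < ∑ l, k l → q ^ e ≠ -1

namespace Admissible

variable {K : Type*} [Field K] {n s : ℕ} {q : K} {x : Fin n → K} {z : Fin s → K} {k : Fin s → ℕ}
  (h : Admissible q x z k)
include h

theorem zpow_two_mul_ne_one (i : Fin n) (u : ℤˣ) : x i ^ (2 * (u : ℤ)) ≠ 1 := by
  rw [zpow_mul, zpow_ofNat]
  rcases Int.units_eq_one_or u with rfl | rfl <;> simpa using h.x_sq i

theorem mul_zpow_neg_ne_one (l : Fin s) (i : Fin n) (u : ℤˣ) : z l * x i ^ (-(u : ℤ)) ≠ 1 := by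
  have := h.zx l i 0 (h.k_pos l)
  rw [pow_zero, one_mul, one_mul, div_eq_mul_inv] at this
  rcases Int.units_eq_one_or u with rfl | rfl
  · simpa using this.2
  · simpa using this.1

theorem zpow_mul_zpow_ne_one {i j : Fin n} (hij : i < j) (u v : ℤˣ) :
    x i ^ (u : ℤ) * x j ^ (v : ℤ) ≠ 1 := by
  obtain ⟨hmul, hne⟩ := h.xx i j hij
  rcases Int.units_eq_one_or u with rfl | rfl <;> rcases Int.units_eq_one_or v with rfl | rfl <;>
    simp only [Units.val_one, Units.val_neg, zpow_one, zpow_neg]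
  · exact hmul
  · rwa [ne_eq, mul_inv_eq_one₀ (h.x_ne j)]
  · rwa [ne_eq, inv_mul_eq_one₀ (h.x_ne i)]
  · rwa [← mul_inv, ne_eq, inv_eq_one]

theorem neg_mul_zpow_ne_one {e : ℤ} (he : (n : ℤ) - (∑ l, k l : ℕ) ≤ e) (he' : e < 0) :
    -q * q ^ e ≠ 1 := by
  obtain ⟨j, rfl⟩ : ∃ j : ℕ, e = -(j : ℤ) - 1 := ⟨(-e - 1).toNat, by omega⟩
  rw [neg_mul, ← zpow_one_add₀ h.q_ne, add_sub_cancel, zpow_neg, zpow_natCast, ← inv_neg, ne_eq,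
    inv_eq_one, neg_eq_iff_eq_neg]
  exact h.q_pow j (by omega)

end Admissible

section transport

variable {A F K : Type*} [CommRing A] [Field F] [Algebra A F] [IsFractionRing A F]
  [Field K] {φ : A →+* K} {n s : ℕ} {q : F} {x : Fin n → F} {z : Fin s → F}
  {q' : K} {x' : Fin n → K} {z' : Fin s → K} {k : Fin s → ℕ}

open HasValue

theorem HasValue.signSide (h : Admissible q' x' z' k) (hq : HasValue φ q q')
    (hx : ∀ i, HasValue φ (x i) (x' i)) (hz : ∀ l, HasValue φ (z l) (z' l)) :
    HasValue φ (signSide q x z k) (signSide q' x' z' k) := by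
  have hxu (i : Fin n) (u : ℤ) : HasValue φ (x i ^ u) (x' i ^ u) := (hx i).zpow (h.x_ne i) u
  have hxx (i j : Fin n) (u v : ℤ) : HasValue φ (x i ^ u * x j ^ v) (x' i ^ u * x' j ^ v) :=
    (hxu i u).mul (hxu j v)
  refine sum fun σ _ => mul (prod fun i _ => mul ?_ (prod fun l _ => ?_))
    (prod fun i _ => prod fun j hj => ?_)
  · exact (one.sub (hq.mul (hxu i _))).div (one.sub (hxu i _))
      (sub_ne_zero.2 (h.zpow_two_mul_ne_one i _).symm)
  · exact (one.sub (((hq.pow _).mul (hz l)).mul (hxu i _))).div (one.sub ((hz l).mul (hxu i _)))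
      (sub_ne_zero.2 (h.mul_zpow_neg_ne_one l i _).symm)
  · exact (one.sub (hq.mul (hxx i j _ _))).div (one.sub (hxx i j _ _))
      (sub_ne_zero.2 (h.zpow_mul_zpow_ne_one (Finset.mem_Ioi.1 hj) _ _).symm)

theorem HasValue.coeffC (h : Admissible q' x' z' k) (hq : HasValue φ q q')
    (hz : ∀ l, HasValue φ (z l) (z' l)) {m : Fin s → ℕ} (hm : m ≤ k) :
    HasValue φ (coeffC q k z m) (coeffC q' k z' m) := by
  have hmul (a b : Fin s) : HasValue φ (z a * z b) (z' a * z' b) := (hz a).mul (hz b)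
  have hdiv (a b : Fin s) : HasValue φ (z a / z b) (z' a / z' b) := (hz a).div (hz b) (h.z_ne b)
  have hmk (a : Fin s) : m a ≤ k a := hm a
  refine mul (mul (prod fun a _ => prod fun b hb => ?_) (prod fun a _ => prod fun b _ => ?_))
    (prod fun a _ => prod fun b _ => mul ?_ ?_)
  · exact (((hq.pow _).mul (hz a)).sub ((hq.pow _).mul (hz b))).div ((hz a).sub (hz b))
      (sub_ne_zero.2 (h.zz_ne a b (Finset.mem_Ioi.1 hb).ne))
  · exact (one.sub (((hq.pow _).mul (hz a)).mul (hz b))).div (one.sub (hmul a b))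
      (sub_ne_zero.2 (by simpa using (h.zz_mul a b 0 (Nat.zero_le _)).symm))
  · refine (((hq.zpow h.q_ne _).mul (hdiv a b)).qPoch hq _).div
      ((hq.mul (hdiv a b)).qPoch hq _) (qPoch_ne_zero fun i hi => ?_)
    rw [mul_right_comm, ← pow_succ']
    exact h.zz_div a b (i + 1) (by omega) (hi.trans_le (hmk a))
  · refine ((hmul a b).qPoch hq _).div (((hq.pow _).mul (hmul a b)).qPoch hq _)
      (qPoch_ne_zero fun i hi => ?_)
    rw [mul_right_comm, ← pow_add]
    exact h.zz_mul a b (1 + k b + i) (by have := hmk a; omega)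

theorem HasValue.boxSide (h : Admissible q' x' z' k) (hq : HasValue φ q q')
    (hx : ∀ i, HasValue φ (x i) (x' i)) (hz : ∀ l, HasValue φ (z l) (z' l)) :
    HasValue φ (boxSide q x z k) (boxSide q' x' z' k) := by
  have hzz (a b : Fin s) : HasValue φ (z a * z b) (z' a * z' b) := (hz a).mul (hz b)
  have hxz (i : Fin n) (l : Fin s) : HasValue φ (x i * z l) (x' i * z' l) := (hx i).mul (hz l)
  have hzx (l : Fin s) (i : Fin n) : HasValue φ (z l / x i) (z' l / x' i) :=
    (hz l).div (hx i) (h.x_ne i)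
  have hden (a b : Fin s) : _root_.qPoch (q' * (z' a * z' b)) q' (k a) ≠ 0 :=
    qPoch_ne_zero fun i hi => by
      rw [mul_right_comm, ← pow_succ']
      exact h.zz_mul a b (i + 1) (by omega)
  refine mul (mul (mul (mul (hq.zpow h.q_ne _) (hq.neg.qPochInt hq h.q_ne ?_))
    (prod fun a _ => prod fun b _ => ?_)) (prod fun a _ => ?_))
    (sum fun m hm => mul (mul (mul (one.neg.pow _) ?_) (hq.zpow h.q_ne _))
      (prod fun i _ => prod fun l _ => mul ?_ ?_))
  · exact fun e => h.neg_mul_zpow_ne_one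
  · exact (((hq.pow _).mul (hzz a b)).qPoch hq _).div ((hq.mul (hzz a b)).qPoch hq _) (hden a b)
  · exact ((hq.mul ((hz a).pow 2)).qPoch (hq.pow 2) _).div ((hq.mul ((hz a).pow 2)).qPoch hq _)
      (sq (z' a) ▸ hden a a)
  · exact HasValue.coeffC h hq hz (Finset.mem_Iic.1 hm)
  · refine ((hq.mul (hxz i l)).qPoch hq _).div ((hxz i l).qPoch hq _) (qPoch_ne_zero fun e he => ?_)
    rw [mul_comm, mul_comm (x' i)]
    exact (h.zx l i e (he.trans_le (Finset.mem_Iic.1 hm l))).1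
  · refine ((hq.mul (hzx l i)).qPoch hq _).div ((hzx l i).qPoch hq _) (qPoch_ne_zero fun e he => ?_)
    rw [mul_comm]
    exact (h.zx l i e (he.trans_le (Finset.mem_Iic.1 hm l))).2

end transport

section indeterminates

variable {n s : ℕ}

/-- The ring of integer polynomials in the indeterminates `q`, `x` and `z`, which are indexed by
`none`, `Fin n` and `Fin s`. -/
abbrev ParamRing (n s : ℕ) : Type := MvPolynomial (Option (Fin n ⊕ Fin s)) ℤ

/-- The field of rational functions in the indeterminates `q`, `x` and `z`. -/
abbrev ParamField (n s : ℕ) : Type := FractionRing (ParamRing n s)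

/-- The indeterminate `q`. -/
noncomputable def indetQ : ParamField n s := algebraMap (ParamRing n s) _ (MvPolynomial.X none)

/-- The indeterminates `x`. -/
noncomputable def indetX (i : Fin n) : ParamField n s :=
  algebraMap (ParamRing n s) _ (MvPolynomial.X (some (Sum.inl i)))

/-- The indeterminates `z`. -/
noncomputable def indetZ (l : Fin s) : ParamField n s :=
  algebraMap (ParamRing n s) _ (MvPolynomial.X (some (Sum.inr l)))

/-- The homomorphism that assigns values to the indeterminates. -/
noncomputable def paramHom {R : Type*} [CommRing R] (q : R) (x : Fin n → R) (z : Fin s → R) :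
    ParamRing n s →+* R :=
  MvPolynomial.eval₂Hom (Int.castRingHom R) fun o => o.elim q (Sum.elim x z)

variable {K : Type*} [Field K] (q : K) (x : Fin n → K) (z : Fin s → K)

theorem hasValue_indetQ : HasValue (paramHom q x z) (indetQ : ParamField n s) q := by
  simpa [paramHom, indetQ] using HasValue.of_map (F := ParamField n s) (paramHom q x z) (.X none)

theorem hasValue_indetX (i : Fin n) :
    HasValue (paramHom q x z) (indetX i : ParamField n s) (x i) := by
  simpa [paramHom, indetX] using
    HasValue.of_map (F := ParamField n s) (paramHom q x z) (.X (some (.inl i)))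

theorem hasValue_indetZ (l : Fin s) :
    HasValue (paramHom q x z) (indetZ l : ParamField n s) (z l) := by
  simpa [paramHom, indetZ] using
    HasValue.of_map (F := ParamField n s) (paramHom q x z) (.X (some (.inr l)))

theorem hasValue_blockVar_indet (p : Fin s ×ₗ ℕ) :
    HasValue (paramHom q x z) (blockVar (indetQ : ParamField n s) indetZ p) (blockVar q z p) :=
  ((hasValue_indetQ q x z).pow _).mul (hasValue_indetZ q x z _)

theorem blockVar_indet_injective :
    Function.Injective (blockVar (indetQ : ParamField n s) indetZ) := by
  intro p p' heq
  by_contra hne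
  by_cases hl : (ofLex p).1 = (ofLex p').1
  · have he : (ofLex p).2 ≠ (ofLex p').2 := fun he => hne (ofLex.injective (Prod.ext hl he))
    refine (hasValue_blockVar_indet (2 : ℚ) 1 1 p).ne (hasValue_blockVar_indet 2 1 1 p') ?_ heq
    simpa [blockVar] using he
  · refine (hasValue_blockVar_indet (1 : ℚ) 1 (Pi.single (ofLex p).1 1) p).ne
      (hasValue_blockVar_indet 1 1 (Pi.single (ofLex p).1 1) p') ?_ heq
    simp [blockVar, Ne.symm hl]

theorem indetZ_mul_indetZ_ne_one (a b : Fin s) : (indetZ a * indetZ b : ParamField n s) ≠ 1 :=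
  ((hasValue_indetZ (1 : ℚ) 1 0 a).mul (hasValue_indetZ 1 1 0 b)).ne .one (by simp)

open HasValue in
theorem generic_indet : Generic (indetQ : ParamField n s) indetX (blockVar indetQ indetZ) where
  q_ne := (hasValue_indetQ (1 : ℚ) 1 1).ne zero one_ne_zero
  q_zpow j := ((hasValue_indetQ (2 : ℚ) 1 1).zpow two_ne_zero j).ne one.neg
    (by linarith [zpow_pos (two_pos (α := ℚ)) j])
  x_ne i := (hasValue_indetX (1 : ℚ) 1 1 i).ne zero one_ne_zero
  z_ne p := (hasValue_blockVar_indet (1 : ℚ) 1 1 p).ne zero (by simp [blockVar])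
  xx_mul i j := ((hasValue_indetX (1 : ℚ) 0 1 i).mul (hasValue_indetX 1 0 1 j)).ne one (by simp)
  xx_ne i j h := (hasValue_indetX (1 : ℚ) (Pi.single i 1) 1 i).ne (hasValue_indetX 1 _ 1 j)
    (by simp [h.symm])
  qxx_mul i j := ((hasValue_indetQ (0 : ℚ) 1 1).mul
    ((hasValue_indetX 0 1 1 i).mul (hasValue_indetX 0 1 1 j))).ne one (by simp)
  qxx_ne i j := ((hasValue_indetQ (0 : ℚ) 1 1).mul (hasValue_indetX 0 1 1 i)).ne
    (hasValue_indetX 0 1 1 j) (by simp)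
  zz_ne _ _ := blockVar_indet_injective.ne
  qzz_mul p p' := ((hasValue_indetQ (0 : ℚ) 1 1).mul
    ((hasValue_blockVar_indet 0 1 1 p).mul (hasValue_blockVar_indet 0 1 1 p'))).ne one (by simp)
  zx_mul p i := ((hasValue_blockVar_indet (1 : ℚ) 0 1 p).mul (hasValue_indetX 1 0 1 i)).ne one
    (by simp)
  zx_ne p i := (hasValue_blockVar_indet (1 : ℚ) 0 1 p).ne (hasValue_indetX 1 0 1 i)
    (by simp [blockVar])
  qzx_mul p i := ((hasValue_indetQ (0 : ℚ) 1 1).mul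
    ((hasValue_blockVar_indet 0 1 1 p).mul (hasValue_indetX 0 1 1 i))).ne one (by simp)
  qzx_ne p i := ((hasValue_indetQ (0 : ℚ) 1 1).mul (hasValue_blockVar_indet 0 1 1 p)).ne
    (hasValue_indetX 0 1 1 i) (by simp)

end indeterminates

/-- The hypotheses after `hk` say exactly that `q`, the `x i` and the `z l` are nonzero and that no
denominator of the identity vanishes; they hold in particular when `q`, `x` and `z` are independent
indeterminates over `ℚ`. -/
theorem theorem10 {K : Type*} [Field K] (n s : ℕ)
    (q : K) (x : Fin n → K) (z : Fin s → K) (k : Fin s → ℕ)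
    (hk : ∀ l, 0 < k l)
    (hq : q ≠ 0) (hx : ∀ i, x i ≠ 0) (hz : ∀ l, z l ≠ 0)
    (hxsq : ∀ i, x i ^ 2 ≠ 1)
    (hxx : ∀ i j, i < j → x i * x j ≠ 1 ∧ x i ≠ x j)
    (hzx : ∀ l i, ∀ e < k l, q ^ e * (z l * x i) ≠ 1 ∧ q ^ e * (z l / x i) ≠ 1)
    (hzz : ∀ a b, ∀ e ≤ k a + k b, q ^ e * (z a * z b) ≠ 1)
    (hzne : ∀ a b, a ≠ b → z a ≠ z b)
    (hzdiv : ∀ a b, ∀ e : ℕ, 1 ≤ e → e ≤ k a → q ^ e * (z a / z b) ≠ 1)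
    (hneg : ∀ e : ℕ, n + e < ∑ l, k l → q ^ e ≠ -1) :
    (∑ σ : Fin n → ℤˣ,
      (∏ i,
        ((1 - q * x i ^ (2 * (σ i : ℤ))) / (1 - x i ^ (2 * (σ i : ℤ))) *
          ∏ l, (1 - q ^ k l * z l * x i ^ (-(σ i : ℤ))) / (1 - z l * x i ^ (-(σ i : ℤ))))) *
      ∏ i, ∏ j ∈ Finset.Ioi i,
        (1 - q * (x i ^ (σ i : ℤ) * x j ^ (σ j : ℤ))) /
          (1 - x i ^ (σ i : ℤ) * x j ^ (σ j : ℤ)))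
    = q ^ ((n : ℤ) * ((∑ l, k l : ℕ) : ℤ) - ((∑ l, k l).choose 2 : ℤ)) *
      qPochInt (-q) q ((n : ℤ) - ((∑ l, k l : ℕ) : ℤ)) *
      (∏ a, ∏ b ∈ Finset.Ioi a,
        qPoch (q ^ (k b + 1) * (z a * z b)) q (k a) / qPoch (q * (z a * z b)) q (k a)) *
      (∏ a, qPoch (q * z a ^ 2) (q ^ 2) (k a) / qPoch (q * z a ^ 2) q (k a)) *
      ∑ m ∈ Finset.Iic k,
        (-1) ^ (∑ l, m l) * coeffC q k z m *
          q ^ ((((∑ l, k l : ℕ) : ℤ) - (n : ℤ)) * ((∑ l, m l : ℕ) : ℤ)) *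
          ∏ i, ∏ l,
            (qPoch (q * (x i * z l)) q (m l) / qPoch (x i * z l) q (m l)) *
            (qPoch (q * (z l / x i)) q (m l) / qPoch (z l / x i) q (m l)) := by
  change signSide q x z k = boxSide q x z k
  have h : Admissible q x z k := ⟨hk, hq, hx, hz, hxsq, hxx, hzx, hzz, hzne, hzdiv, hneg⟩
  have hq' := hasValue_indetQ q x z
  have hx' := hasValue_indetX q x z
  have hz' := hasValue_indetZ q x z
  refine (HasValue.signSide h hq' hx' hz').unique ?_
  rw [signSide_eq_boxSide_of_generic generic_indet indetZ_mul_indetZ_ne_one]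
  exact HasValue.boxSide h hq' hx' hz'
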